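/- Consider the surface growth equation $$u_t=-u_{xxxx}-\bigl((u_x)^2\bigr)_{xx},\qquad x\in\mathbb R,$$ for real-valued functions that are $2\pi$-periodic in $x$ and satisfy $\int_0^{2\pi}u(t,x)\,dx=0$. Let $H^1$ be the space of $2\pi$-periodic mean-zero functions with weak derivative in $L^2(0,2\pi)$ (identified with their continuous representatives), with norm $\|f\|_{H^1}=\|f_x\|_{L^2(0,2\pi)}$. For $0\le T\le\infty$, a *regular solution on $[0,T)$* with initial value $u_0\in H^1$ is a function $u$ with $u(0)=u_0$, $u\in C^0([0,T),H^1)$, which is $C^\infty$ jointly in time and space on $(0,T)\times\mathbb R$ and satisfies the equation pointwise there. **Theorem (Time Condition).** Let $u_0\in H^1$ and $T^*=4\|u_0\|_{L^2(0,2\pi)}^2$. If $u$ is a regular solution on $[0,T^*)$ with initial value $u_0$, then $u$ is globally regular: there is a regular solution $v$ on $[0,\infty)$ with initial value $u_0$ that coincides with $u$ on $[0,T^*)$. Moreover $v$ is unique, in the sense that for every $0\le S\le\infty$ every regular solution on $[0,S)$ with initial value $u_0$ coincides with $v$ on $[0,S)$. -/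

import Mathlib

open MeasureTheory Set Filter Topology
open scoped ENNReal ContDiff

namespace SurfaceGrowth

noncomputable section

/-- `g` is a weak derivative of `f` on the circle `ℝ / 2πℤ`: both are integrable over one
period, and integration by parts holds against all smooth `2π`-periodic test functions. -/
def HasWeakDeriv (f g : ℝ → ℝ) : Prop :=
  IntervalIntegrable f volume 0 (2 * Real.pi) ∧
  IntervalIntegrable g volume 0 (2 * Real.pi) ∧
  ∀ φ : ℝ → ℝ, ContDiff ℝ ∞ φ → Function.Periodic φ (2 * Real.pi) →
    ∫ x in (0 : ℝ)..(2 * Real.pi), f x * deriv φ x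
      = -∫ x in (0 : ℝ)..(2 * Real.pi), g x * φ x

/-- The norm `‖f‖_{H¹} = ‖∂ₓ f‖_{L²(0, 2π)}` used on functions with vanishing mean. Weak
derivatives are unique up to null sets, so the infimum ranges over at most one value; it is `∞`
exactly when `f` has no weak derivative in `L²(0, 2π)`. -/
def h1Norm (f : ℝ → ℝ) : ℝ≥0∞ :=
  ⨅ (g : ℝ → ℝ) (_ : HasWeakDeriv f g), eLpNorm g 2 (volume.restrict (Ioc 0 (2 * Real.pi)))

/-- The space `H¹` of `2π`-periodic functions with vanishing mean. As usual in dimension one, an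
`H¹` function is identified with its continuous representative. -/
structure MemH1 (f : ℝ → ℝ) : Prop where
  continuous : Continuous f
  periodic : Function.Periodic f (2 * Real.pi)
  mean_zero : ∫ x in (0 : ℝ)..(2 * Real.pi), f x = 0
  h1Norm_lt_top : h1Norm f < ⊤

/-- `u` (time first, space second) is a regular solution on `[0, T)` of
`u_t = -u_xxxx - ((u_x)²)_xx`, `2π`-periodic with vanishing mean, with initial value `u₀`:
`u ∈ C⁰([0, T), H¹)`, `u(0) = u₀`, and on `(0, T) × ℝ` the function `u` is `C^∞` jointly in time
and space and satisfies the equation pointwise. For `T = ⊤` the solution is global. Values of `u`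
at other times play no role. -/
structure IsRegularSolution (u₀ : ℝ → ℝ) (T : EReal) (u : ℝ → ℝ → ℝ) : Prop where
  initial : u 0 = u₀
  memH1 : ∀ t : ℝ, 0 ≤ t → (t : EReal) < T → MemH1 (u t)
  continuous_h1 : ∀ t : ℝ, 0 ≤ t → (t : EReal) < T →
    Tendsto (fun s => h1Norm (u s - u t)) (𝓝[{s : ℝ | 0 ≤ s ∧ (s : EReal) < T}] t) (𝓝 0)
  smooth : ContDiffOn ℝ ∞ (fun p : ℝ × ℝ => u p.1 p.2)
    ({t : ℝ | 0 < t ∧ (t : EReal) < T} ×ˢ (univ : Set ℝ))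
  equation : ∀ t : ℝ, 0 < t → (t : EReal) < T → ∀ x : ℝ,
    deriv (fun s => u s x) t
      = -iteratedDeriv 4 (u t) x - iteratedDeriv 2 (fun y => (deriv (u t) y) ^ 2) x

/-- The time `T*(u₀) = 4 ‖u₀‖²_{L²(0, 2π)}`. -/
def criticalTime (u₀ : ℝ → ℝ) : ℝ :=
  4 * ∫ x in (0 : ℝ)..(2 * Real.pi), (u₀ x) ^ 2

end

end SurfaceGrowth

/-! The argument combines energy dissipation with global existence for small data. Testing the
equation with `u` kills the quadratic term, because `u_xx (u_x)^2` is a third of the derivative of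
`(u_x)^3`. Hence `d/dt ‖u‖² = -2 ‖u_xx‖²` in `L²`. If `‖u_xx‖²` stayed above `1/7` on all of `(0,
T*)`, the energy would fall at rate at least `2/7`. Over a time close to `T* = 4 ‖u₀‖²` it would
lose more than the `‖u₀‖²` available; any threshold above `1/8` would do. So `‖u_xx(t₀)‖² ≤ 1/7` at
some `t₀` in `(0, T*)` (`exists_integral_sq_deriv_deriv_le`).

From the smooth datum `u(t₀)` a global solution is built in Fourier variables
(`exists_isFourierSolution`). With `γ_k = k² c_k` the equation reads `γ_k' = -k⁴ γ_k - k⁴ N_k(γ)`,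
where `N_k` is the convolution of `γ_j / j` with itself. The Duhamel kernel `k⁴ exp(-k⁴ (t - s))`
has mass at most one, so the factor `k⁴` costs nothing in the supremum over time
(`norm_duhamel_sub_le`). By Cauchy-Schwarz the convolution is bounded on `ℓ²`, with squared constant
`∑ j⁻⁴ = π⁴/45`. The Picard iterates are dominated, increment by increment, by a time-independent
monotone scheme `majorant`. That scheme stays in a fixed `ℓ²` ball for small data, so the iterates
converge without a contraction argument. A bootstrap gives rapid decay of the coefficients
(`fixedPoint_decay`), hence a smooth solution. The resulting smallness condition is `16 π³/90 ·
‖f_xx‖² ≤ 1`, that is `‖f_xx‖²` below about `0.18`. The value `1/7` lies between this and `1/8`.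

Uniqueness (`IsRegularSolution.eq`) is a Gronwall estimate for the `L²` distance of two solutions,
with interpolation absorbing all second derivatives into the dissipation. It also shows that the old
and new solutions agree on `[t₀, T*)`, so they can be glued. -/

namespace SurfaceGrowth

noncomputable section

/-! ### Integration over one period -/

/-- Lebesgue measure on one period. -/
abbrev periodMeasure : Measure ℝ := volume.restrict (Ioc 0 (2 * Real.pi))

theorem integral_mul_deriv_of_periodic {f g f' g' : ℝ → ℝ}
    (hf : ∀ x, HasDerivAt f (f' x) x) (hg : ∀ x, HasDerivAt g (g' x) x)
    (cf : Continuous f') (cg : Continuous g')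
    (pf : Function.Periodic f (2 * Real.pi)) (pg : Function.Periodic g (2 * Real.pi)) :
    ∫ x in (0 : ℝ)..(2 * Real.pi), f x * g' x = -∫ x in (0 : ℝ)..(2 * Real.pi), f' x * g x := by
  rw [intervalIntegral.integral_mul_deriv_eq_deriv_mul (fun x _ => hf x) (fun x _ => hg x)
    (cf.intervalIntegrable _ _) (cg.intervalIntegrable _ _)]
  have h1 := pf 0
  have h2 := pg 0
  simp only [zero_add] at h1 h2
  rw [h1, h2]; ring

theorem integral_deriv_of_periodic {f f' : ℝ → ℝ} (hf : ∀ x, HasDerivAt f (f' x) x)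
    (cf : Continuous f') (pf : Function.Periodic f (2 * Real.pi)) :
    ∫ x in (0 : ℝ)..(2 * Real.pi), f' x = 0 := by
  rw [intervalIntegral.integral_eq_sub_of_hasDerivAt (fun x _ => hf x)
    (cf.intervalIntegrable _ _)]
  have h1 := pf 0
  simp only [zero_add] at h1
  rw [h1, sub_self]

theorem periodic_deriv {f : ℝ → ℝ} {T : ℝ} (pf : Function.Periodic f T) :
    Function.Periodic (deriv f) T := by
  intro x
  rw [← deriv_comp_add_const]
  congr 1
  exact funext pf


theorem memLp_two_of_continuous {f : ℝ → ℝ} (hf : Continuous f) : MemLp f 2 periodMeasure := by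
  rw [memLp_two_iff_integrable_sq hf.aestronglyMeasurable]
  exact ((hf.pow 2).integrableOn_Icc (a := 0) (b := 2 * Real.pi)).mono_set Ioc_subset_Icc_self

theorem eLpNorm_two_eq {f : ℝ → ℝ} (hf : MemLp f 2 periodMeasure) :
    eLpNorm f 2 periodMeasure
      = ENNReal.ofReal (Real.sqrt (∫ x in (0 : ℝ)..(2 * Real.pi), (f x) ^ 2)) := by
  rw [hf.eLpNorm_eq_integral_rpow_norm (by norm_num) (by norm_num),
    intervalIntegral.integral_of_le Real.two_pi_pos.le, Real.sqrt_eq_rpow]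
  simp

/-! ### Weak derivatives and the norm of `H¹` -/

theorem hasWeakDeriv_of_hasDerivAt {f g : ℝ → ℝ} (hf : ∀ x, HasDerivAt f (g x) x)
    (cg : Continuous g) (pf : Function.Periodic f (2 * Real.pi)) : HasWeakDeriv f g := by
  have cf : Continuous f := continuous_iff_continuousAt.2 fun x => (hf x).continuousAt
  refine ⟨cf.intervalIntegrable _ _, cg.intervalIntegrable _ _, fun φ hφ pφ => ?_⟩
  exact integral_mul_deriv_of_periodic hf
    (fun x => (hφ.differentiable (by simp)).differentiableAt.hasDerivAt) cg
    (hφ.continuous_deriv (by simp)) pf pφ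

theorem h1Norm_le_of_hasWeakDeriv {f g : ℝ → ℝ} (h : HasWeakDeriv f g) :
    h1Norm f ≤ eLpNorm g 2 periodMeasure :=
  iInf₂_le g h

theorem h1Norm_le_of_hasDerivAt {f g : ℝ → ℝ} (hf : ∀ x, HasDerivAt f (g x) x)
    (cg : Continuous g) (pf : Function.Periodic f (2 * Real.pi)) :
    h1Norm f ≤ ENNReal.ofReal (Real.sqrt (∫ x in (0 : ℝ)..(2 * Real.pi), (g x) ^ 2)) :=
  (h1Norm_le_of_hasWeakDeriv (hasWeakDeriv_of_hasDerivAt hf cg pf)).trans_eq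
    (eLpNorm_two_eq (memLp_two_of_continuous cg))

theorem HasWeakDeriv.aestronglyMeasurable {f g : ℝ → ℝ} (h : HasWeakDeriv f g) :
    AEStronglyMeasurable g periodMeasure :=
  ((intervalIntegrable_iff_integrableOn_Ioc_of_le Real.two_pi_pos.le).1 h.2.1).1

theorem memLp_of_eLpNorm_ne_top {f g : ℝ → ℝ} (h : HasWeakDeriv f g)
    (hg : eLpNorm g 2 periodMeasure ≠ ⊤) : MemLp g 2 periodMeasure :=
  ⟨h.aestronglyMeasurable, lt_top_iff_ne_top.2 hg⟩

theorem HasWeakDeriv.add {f₁ g₁ f₂ g₂ : ℝ → ℝ} (h₁ : HasWeakDeriv f₁ g₁)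
    (h₂ : HasWeakDeriv f₂ g₂) : HasWeakDeriv (f₁ + f₂) (g₁ + g₂) := by
  refine ⟨h₁.1.add h₂.1, h₁.2.1.add h₂.2.1, fun φ hφ pφ => ?_⟩
  have c1 : ContinuousOn (deriv φ) (uIcc 0 (2 * Real.pi)) :=
    (hφ.continuous_deriv (by simp)).continuousOn
  have c2 : ContinuousOn φ (uIcc 0 (2 * Real.pi)) := hφ.continuous.continuousOn
  simp only [Pi.add_apply, add_mul]
  rw [intervalIntegral.integral_add (h₁.1.mul_continuousOn c1) (h₂.1.mul_continuousOn c1),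
    intervalIntegral.integral_add (h₁.2.1.mul_continuousOn c2) (h₂.2.1.mul_continuousOn c2),
    h₁.2.2 φ hφ pφ, h₂.2.2 φ hφ pφ]
  ring

theorem HasWeakDeriv.neg {f g : ℝ → ℝ} (h : HasWeakDeriv f g) : HasWeakDeriv (-f) (-g) := by
  refine ⟨h.1.neg, h.2.1.neg, fun φ hφ pφ => ?_⟩
  simp only [Pi.neg_apply, neg_mul, intervalIntegral.integral_neg]
  rw [h.2.2 φ hφ pφ]

theorem h1Norm_add_le (f₁ f₂ : ℝ → ℝ) : h1Norm (f₁ + f₂) ≤ h1Norm f₁ + h1Norm f₂ := by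
  have key : ∀ g₁ g₂, HasWeakDeriv f₁ g₁ → HasWeakDeriv f₂ g₂ →
      h1Norm (f₁ + f₂) ≤ eLpNorm g₁ 2 periodMeasure + eLpNorm g₂ 2 periodMeasure :=
    fun g₁ g₂ h₁ h₂ => (h1Norm_le_of_hasWeakDeriv (h₁.add h₂)).trans
      (eLpNorm_add_le h₁.aestronglyMeasurable h₂.aestronglyMeasurable (by norm_num))
  unfold h1Norm at key ⊢
  simp only [ENNReal.iInf_add, ENNReal.add_iInf]
  exact le_iInf₂ fun g₁ h₁ => le_iInf₂ fun g₂ h₂ => key g₂ g₁ h₂ h₁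

theorem h1Norm_neg_le (f : ℝ → ℝ) : h1Norm (-f) ≤ h1Norm f :=
  le_iInf₂ fun g hg => (h1Norm_le_of_hasWeakDeriv hg.neg).trans_eq (eLpNorm_neg g 2 _)

theorem h1Norm_sub_le (f₁ f₂ : ℝ → ℝ) : h1Norm (f₁ - f₂) ≤ h1Norm f₁ + h1Norm f₂ := by
  rw [sub_eq_add_neg]
  exact (h1Norm_add_le _ _).trans (add_le_add le_rfl (h1Norm_neg_le _))

/-- Testing any competitor `g` and the classical derivative against `φ = f'` gives `∫ g f' = ∫
f'^2`. Then `0 ≤ ∫ (g - f')^2` yields the bound, with no need for almost-everywhere uniqueness of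
weak derivatives. -/
theorem le_h1Norm_of_contDiff {f : ℝ → ℝ} (hf : ContDiff ℝ ∞ f)
    (pf : Function.Periodic f (2 * Real.pi)) :
    ENNReal.ofReal (Real.sqrt (∫ x in (0 : ℝ)..(2 * Real.pi), (deriv f x) ^ 2)) ≤ h1Norm f := by
  refine le_iInf₂ fun g hg => ?_
  by_cases htop : eLpNorm g 2 periodMeasure = ⊤
  · exact htop ▸ le_top
  have hL := memLp_of_eLpNorm_ne_top hg htop
  have hf' : ContDiff ℝ ∞ (deriv f) := (contDiff_infty_iff_deriv.1 hf).2
  have pf' := periodic_deriv pf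
  have cf' := hf'.continuous
  have hff := hasWeakDeriv_of_hasDerivAt
    (fun x => (hf.differentiable (by simp)).differentiableAt.hasDerivAt) cf' pf
  have e1 := hg.2.2 _ hf' pf'
  have e2 := hff.2.2 _ hf' pf'
  have e3 : ∫ x in (0 : ℝ)..(2 * Real.pi), g x * deriv f x
      = ∫ x in (0 : ℝ)..(2 * Real.pi), deriv f x * deriv f x := by linarith
  refine (ENNReal.ofReal_le_ofReal (Real.sqrt_le_sqrt ?_)).trans_eq (eLpNorm_two_eq hL).symm
  have i1 : IntervalIntegrable (fun x => g x ^ 2) volume 0 (2 * Real.pi) :=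
    (intervalIntegrable_iff_integrableOn_Ioc_of_le Real.two_pi_pos.le).2 hL.integrable_sq
  have i2 : IntervalIntegrable (fun x => g x * deriv f x) volume 0 (2 * Real.pi) :=
    hg.2.1.mul_continuousOn cf'.continuousOn
  have i3 : IntervalIntegrable (fun x => deriv f x * deriv f x) volume 0 (2 * Real.pi) :=
    (cf'.mul cf').intervalIntegrable _ _
  have h0 : 0 ≤ ∫ x in (0 : ℝ)..(2 * Real.pi),
      (g x ^ 2 - 2 * (g x * deriv f x) + deriv f x * deriv f x) :=
    intervalIntegral.integral_nonneg Real.two_pi_pos.le fun x _ => by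
      nlinarith [sq_nonneg (g x - deriv f x)]
  rw [intervalIntegral.integral_add (i1.sub (i2.const_mul 2)) i3,
    intervalIntegral.integral_sub i1 (i2.const_mul 2), intervalIntegral.integral_const_mul,
    e3] at h0
  have : ∫ x in (0 : ℝ)..(2 * Real.pi), deriv f x ^ 2
      = ∫ x in (0 : ℝ)..(2 * Real.pi), deriv f x * deriv f x := by simp only [sq]
  linarith

/-! ### Fourier coefficients -/

/-- The character `x ↦ e^{ikx}`. -/
def character (k : ℤ) (x : ℝ) : ℂ := Complex.exp (k * x * Complex.I)

/-- The Fourier coefficients of a function on `ℝ / 2πℤ`. -/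
def fourierCoefficient (f : ℝ → ℝ) (k : ℤ) : ℂ :=
  fourierCoeffOn Real.two_pi_pos (fun x => (f x : ℂ)) k

/-- The period appears as `2 * Real.pi - 0` because `fourierCoeffOn` on an interval from `a` to `b`
is defined through `AddCircle (b - a)`. -/
theorem fourier_eq_character (k : ℤ) (x : ℝ) :
    fourier k (x : AddCircle (2 * Real.pi - 0)) = character k x := by
  rw [fourier_coe_apply, character]
  congr 1
  have : (Real.pi : ℂ) ≠ 0 := by exact_mod_cast Real.pi_ne_zero
  push_cast
  field_simp
  ring

theorem fourierCoefficient_eq (f : ℝ → ℝ) (k : ℤ) :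
    fourierCoefficient f k
      = (1 / (2 * Real.pi) : ℝ) * ∫ x in (0 : ℝ)..(2 * Real.pi), character (-k) x * f x := by
  rw [fourierCoefficient, fourierCoeffOn_eq_integral, Complex.real_smul]
  simp_rw [smul_eq_mul, fourier_eq_character, sub_zero]

theorem character_periodic (k : ℤ) : Function.Periodic (character k) (2 * Real.pi) := by
  intro x
  rw [character, character, ← mul_one (Complex.exp (k * x * Complex.I)),
    ← Complex.exp_int_mul_two_pi_mul_I k, ← Complex.exp_add]
  congr 1
  push_cast
  ring

theorem hasDerivAt_character (k : ℤ) (x : ℝ) :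
    HasDerivAt (character k) (Complex.I * k * character k x) x := by
  have h : HasDerivAt (fun y : ℝ => (k * y * Complex.I : ℂ)) (k * 1 * Complex.I) x :=
    ((Complex.ofRealCLM.hasDerivAt (x := x)).const_mul (k : ℂ)).mul_const Complex.I
  refine h.cexp.congr_deriv ?_
  rw [character]
  ring

theorem norm_character (k : ℤ) (x : ℝ) : ‖character k x‖ = 1 := by
  rw [character, show (k * x * Complex.I : ℂ) = ((k * x : ℝ) : ℂ) * Complex.I by push_cast; ring]
  exact Complex.norm_exp_ofReal_mul_I _

theorem character_add (j k : ℤ) (x : ℝ) :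
    character (j + k) x = character j x * character k x := by
  rw [character, character, character, ← Complex.exp_add]
  congr 1
  push_cast
  ring

theorem conj_character (k : ℤ) (x : ℝ) :
    (starRingEnd ℂ) (character k x) = character (-k) x := by
  rw [character, character, ← Complex.exp_conj]
  congr 1
  simp

theorem contDiff_character (k : ℤ) : ContDiff ℝ ∞ (character k) := by
  unfold character
  exact ((contDiff_const.mul Complex.ofRealCLM.contDiff).mul contDiff_const).cexp

theorem hasSum_sq_fourierCoefficient {f : ℝ → ℝ} (hf : MemLp f 2 periodMeasure) :
    HasSum (fun k => ‖fourierCoefficient f k‖ ^ 2)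
      ((2 * Real.pi)⁻¹ * ∫ x in (0 : ℝ)..(2 * Real.pi), (f x) ^ 2) := by
  have h := hasSum_sq_fourierCoeffOn Real.two_pi_pos (f := fun x => (f x : ℂ)) hf.ofReal
  simpa [fourierCoefficient] using h

theorem intervalIntegrable_ofReal {f : ℝ → ℝ} {a b : ℝ} (hf : IntervalIntegrable f volume a b) :
    IntervalIntegrable (fun x => (f x : ℂ)) volume a b :=
  ⟨Integrable.ofReal hf.1, Integrable.ofReal hf.2⟩

/-- Weak differentiation multiplies the `k`-th Fourier coefficient by `ik`. -/
theorem fourierCoefficient_of_hasWeakDeriv {f g : ℝ → ℝ} (h : HasWeakDeriv f g) (k : ℤ) :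
    fourierCoefficient g k = Complex.I * k * fourierCoefficient f k := by
  -- Test functions in `HasWeakDeriv` are real, so the character is tested through its real and
  -- imaginary parts separately.
  have hre : ContDiff ℝ ∞ fun x => (character (-k) x).re :=
    Complex.reCLM.contDiff.comp (contDiff_character _)
  have him : ContDiff ℝ ∞ fun x => (character (-k) x).im :=
    Complex.imCLM.contDiff.comp (contDiff_character _)
  have dre : ∀ x, deriv (fun x => (character (-k) x).re) x = k * (character (-k) x).im := by
    intro x
    have := (Complex.reCLM.hasFDerivAt.comp_hasDerivAt x (hasDerivAt_character (-k) x)).deriv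
    simpa [Function.comp_def] using this
  have dim : ∀ x, deriv (fun x => (character (-k) x).im) x = -(k * (character (-k) x).re) := by
    intro x
    have := (Complex.imCLM.hasFDerivAt.comp_hasDerivAt x (hasDerivAt_character (-k) x)).deriv
    simpa [Function.comp_def] using this
  have e1 := h.2.2 _ hre (fun x => by simp [character_periodic (-k) x])
  have e2 := h.2.2 _ him (fun x => by simp [character_periodic (-k) x])
  simp only [dre, dim] at e1 e2
  have split : ∀ u : ℝ → ℝ, IntervalIntegrable u volume 0 (2 * Real.pi) →
      ∫ x in (0 : ℝ)..(2 * Real.pi), character (-k) x * u x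
        = ((∫ x in (0 : ℝ)..(2 * Real.pi), u x * (character (-k) x).re : ℝ) : ℂ)
          + (∫ x in (0 : ℝ)..(2 * Real.pi), u x * (character (-k) x).im : ℝ) * Complex.I := by
    intro u hu
    rw [← intervalIntegral.integral_ofReal, ← intervalIntegral.integral_ofReal,
      ← intervalIntegral.integral_mul_const, ← intervalIntegral.integral_add]
    · refine intervalIntegral.integral_congr fun x _ => ?_
      conv_lhs => rw [← Complex.re_add_im (character (-k) x)]
      push_cast
      ring
    · exact intervalIntegrable_ofReal (hu.mul_continuousOn hre.continuous.continuousOn)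
    · exact (intervalIntegrable_ofReal
        (hu.mul_continuousOn him.continuous.continuousOn)).mul_const _
  rw [fourierCoefficient_eq, fourierCoefficient_eq, split f h.1, split g h.2.1]
  have f1 : ∫ x in (0 : ℝ)..(2 * Real.pi), f x * (k * (character (-k) x).im)
      = k * ∫ x in (0 : ℝ)..(2 * Real.pi), f x * (character (-k) x).im := by
    rw [← intervalIntegral.integral_const_mul]
    exact intervalIntegral.integral_congr fun x _ => by ring
  have f2 : ∫ x in (0 : ℝ)..(2 * Real.pi), f x * -(k * (character (-k) x).re)
      = -(k * ∫ x in (0 : ℝ)..(2 * Real.pi), f x * (character (-k) x).re) := by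
    rw [← intervalIntegral.integral_const_mul, ← intervalIntegral.integral_neg]
    exact intervalIntegral.integral_congr fun x _ => by ring
  rw [f1] at e1
  rw [f2] at e2
  rw [show ∫ x in (0 : ℝ)..(2 * Real.pi), g x * (character (-k) x).re
      = -(k * ∫ x in (0 : ℝ)..(2 * Real.pi), f x * (character (-k) x).im) by linarith,
    show ∫ x in (0 : ℝ)..(2 * Real.pi), g x * (character (-k) x).im
      = k * ∫ x in (0 : ℝ)..(2 * Real.pi), f x * (character (-k) x).re by linarith]
  simp only [Complex.ofReal_neg, Complex.ofReal_mul, Complex.ofReal_intCast]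
  linear_combination (-((1 / (2 * Real.pi) : ℝ) : ℂ) * k *
    ((∫ x in (0 : ℝ)..(2 * Real.pi), f x * (character (-k) x).im : ℝ) : ℂ)) * Complex.I_sq

theorem fourierCoefficient_zero_of_mean_zero {f : ℝ → ℝ}
    (hf : ∫ x in (0 : ℝ)..(2 * Real.pi), f x = 0) : fourierCoefficient f 0 = 0 := by
  rw [fourierCoefficient_eq]
  simp [character, intervalIntegral.integral_ofReal, hf]

/-- The Poincaré inequality in `H¹`. -/
theorem sqrt_integral_sq_le_h1Norm {f : ℝ → ℝ} (cf : Continuous f)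
    (hf : ∫ x in (0 : ℝ)..(2 * Real.pi), f x = 0) :
    ENNReal.ofReal (Real.sqrt (∫ x in (0 : ℝ)..(2 * Real.pi), (f x) ^ 2)) ≤ h1Norm f := by
  refine le_iInf₂ fun g hg => ?_
  by_cases htop : eLpNorm g 2 periodMeasure = ⊤
  · exact htop ▸ le_top
  have hL := memLp_of_eLpNorm_ne_top hg htop
  refine (ENNReal.ofReal_le_ofReal (Real.sqrt_le_sqrt ?_)).trans_eq (eLpNorm_two_eq hL).symm
  have h1 := hasSum_sq_fourierCoefficient (memLp_two_of_continuous cf)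
  have h2 := hasSum_sq_fourierCoefficient hL
  -- By Parseval it suffices to compare coefficients: the zero mode vanishes, and the others gain a
  -- factor `|k| ≥ 1`.
  have hle : ∀ k, ‖fourierCoefficient f k‖ ^ 2 ≤ ‖fourierCoefficient g k‖ ^ 2 := by
    intro k
    rcases eq_or_ne k 0 with rfl | hk
    · rw [fourierCoefficient_zero_of_mean_zero hf]
      simp
    · rw [fourierCoefficient_of_hasWeakDeriv hg k]
      simp only [norm_mul, Complex.norm_I, one_mul, Complex.norm_intCast]
      have : (1 : ℝ) ≤ |(k : ℝ)| := by exact_mod_cast Int.one_le_abs hk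
      gcongr
      nlinarith [norm_nonneg (fourierCoefficient f k)]
  have := hasSum_le hle h1 h2
  exact le_of_mul_le_mul_left this (by positivity)

/-! ### Energy estimates -/

theorem isOpen_timeDomain (T : EReal) : IsOpen {t : ℝ | 0 < t ∧ (t : EReal) < T} :=
  (isOpen_lt continuous_const continuous_id).inter
    (isOpen_lt continuous_coe_real_ereal continuous_const)

theorem contDiff_slice {U : Set ℝ} {u : ℝ → ℝ → ℝ} (hU : IsOpen U)
    (hu : ContDiffOn ℝ ∞ (fun p : ℝ × ℝ => u p.1 p.2) (U ×ˢ (univ : Set ℝ))) {t : ℝ}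
    (ht : t ∈ U) : ContDiff ℝ ∞ (u t) := by
  rw [contDiff_iff_contDiffAt]
  intro x
  have h : ContDiffAt ℝ ∞ (fun p : ℝ × ℝ => u p.1 p.2) (t, x) :=
    hu.contDiffAt ((hU.prod isOpen_univ).mem_nhds ⟨ht, mem_univ _⟩)
  exact h.comp x (contDiffAt_const.prodMk contDiffAt_id)

theorem differentiableAt_time {U : Set ℝ} {u : ℝ → ℝ → ℝ} (hU : IsOpen U)
    (hu : ContDiffOn ℝ ∞ (fun p : ℝ × ℝ => u p.1 p.2) (U ×ˢ (univ : Set ℝ))) {t : ℝ}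
    (ht : t ∈ U) (x : ℝ) : DifferentiableAt ℝ (fun s => u s x) t := by
  have h : ContDiffAt ℝ ∞ (fun p : ℝ × ℝ => u p.1 p.2) (t, x) :=
    hu.contDiffAt ((hU.prod isOpen_univ).mem_nhds ⟨ht, mem_univ _⟩)
  exact (h.comp t (contDiffAt_id.prodMk contDiffAt_const)).differentiableAt (by simp)

/-- Differentiation under the integral sign over one period. -/
theorem hasDerivAt_integral_of_contDiffOn {U : Set ℝ} {u : ℝ → ℝ → ℝ} (hU : IsOpen U)
    (hu : ContDiffOn ℝ ∞ (fun p : ℝ × ℝ => u p.1 p.2) (U ×ˢ (univ : Set ℝ))) {t : ℝ}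
    (ht : t ∈ U) :
    HasDerivAt (fun s => ∫ x in (0 : ℝ)..(2 * Real.pi), u s x)
      (∫ x in (0 : ℝ)..(2 * Real.pi), deriv (fun s => u s x) t) t := by
  set W : ℝ × ℝ → ℝ := fun p => u p.1 p.2 with hW
  have hopen : IsOpen (U ×ˢ (univ : Set ℝ)) := hU.prod isOpen_univ
  have hfd : ContinuousOn (fun p => fderiv ℝ W p (1, 0)) (U ×ˢ (univ : Set ℝ)) :=
    (hu.continuousOn_fderiv_of_isOpen hopen (by simp)).clm_apply continuousOn_const
  have hderiv : ∀ s ∈ U, ∀ x, HasDerivAt (fun s => u s x) (fderiv ℝ W (s, x) (1, 0)) s := by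
    intro s hs x
    have h1 : DifferentiableAt ℝ W (s, x) :=
      (hu.contDiffAt (hopen.mem_nhds ⟨hs, mem_univ _⟩)).differentiableAt (by simp)
    exact h1.hasFDerivAt.comp_hasDerivAt s ((hasDerivAt_id s).prodMk (hasDerivAt_const s x))
  -- Compactness of a closed time interval times one period supplies the constant dominating
  -- function.
  obtain ⟨δ, hδ, hball⟩ := Metric.nhds_basis_closedBall.mem_iff.1 (hU.mem_nhds ht)
  have hK : IsCompact (Metric.closedBall t δ ×ˢ Icc (0 : ℝ) (2 * Real.pi)) :=
    (isCompact_closedBall t δ).prod isCompact_Icc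
  obtain ⟨C, hC⟩ := hK.exists_bound_of_continuousOn
    (hfd.mono (prod_mono hball (subset_univ _)))
  have cslice : ∀ s ∈ U, Continuous (u s) := fun s hs => (contDiff_slice hU hu hs).continuous
  have cder : Continuous fun x => fderiv ℝ W (t, x) (1, 0) :=
    hfd.comp_continuous (by fun_prop) fun x => ⟨ht, mem_univ _⟩
  have key := intervalIntegral.hasDerivAt_integral_of_dominated_loc_of_deriv_le
    (μ := volume) (a := 0) (b := 2 * Real.pi) (F := u)
    (F' := fun s x => fderiv ℝ W (s, x) (1, 0)) (x₀ := t) (bound := fun _ => C)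
    (Metric.closedBall_mem_nhds t hδ)
    (by filter_upwards [hU.mem_nhds ht] with s hs
        exact (cslice s hs).aestronglyMeasurable)
    ((cslice t ht).intervalIntegrable _ _)
    cder.aestronglyMeasurable
    (Eventually.of_forall fun x hx s hs => by
      rw [uIoc_of_le Real.two_pi_pos.le] at hx
      exact hC (s, x) ⟨hs, Ioc_subset_Icc_self hx⟩)
    intervalIntegrable_const
    (Eventually.of_forall fun x _ s hs => hderiv s (hball hs) x)
  refine key.2.congr_deriv ?_
  exact intervalIntegral.integral_congr fun x _ => (hderiv t ht x).deriv.symm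

/-! ### Calculus of smooth periodic functions and interpolation inequalities. -/

theorem contDiff_deriv {f : ℝ → ℝ} (hf : ContDiff ℝ ∞ f) : ContDiff ℝ ∞ (deriv f) :=
  (contDiff_infty_iff_deriv.1 hf).2

theorem hasDerivAt_of_contDiff {f : ℝ → ℝ} (hf : ContDiff ℝ ∞ f) (x : ℝ) :
    HasDerivAt f (deriv f x) x :=
  (hf.differentiable (by simp)).differentiableAt.hasDerivAt

theorem deriv_deriv_sub {f g : ℝ → ℝ} (hf : ContDiff ℝ ∞ f) (hg : ContDiff ℝ ∞ g) :
    deriv (deriv fun y => f y - g y) = fun y => deriv (deriv f) y - deriv (deriv g) y := by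
  have h : deriv (fun y => f y - g y) = fun y => deriv f y - deriv g y :=
    funext fun y => ((hasDerivAt_of_contDiff hf y).sub (hasDerivAt_of_contDiff hg y)).deriv
  rw [h]
  exact funext fun y => ((hasDerivAt_of_contDiff (contDiff_deriv hf) y).sub
    (hasDerivAt_of_contDiff (contDiff_deriv hg) y)).deriv

theorem deriv_deriv_add {f g : ℝ → ℝ} (hf : ContDiff ℝ ∞ f) (hg : ContDiff ℝ ∞ g) :
    deriv (deriv fun y => f y + g y) = fun y => deriv (deriv f) y + deriv (deriv g) y := by
  have h : deriv (fun y => f y + g y) = fun y => deriv f y + deriv g y :=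
    funext fun y => ((hasDerivAt_of_contDiff hf y).add (hasDerivAt_of_contDiff hg y)).deriv
  rw [h]
  exact funext fun y => ((hasDerivAt_of_contDiff (contDiff_deriv hf) y).add
    (hasDerivAt_of_contDiff (contDiff_deriv hg) y)).deriv

theorem integral_mul_deriv_deriv {w r : ℝ → ℝ} (hw : ContDiff ℝ ∞ w) (hr : ContDiff ℝ ∞ r)
    (pw : Function.Periodic w (2 * Real.pi)) (pr : Function.Periodic r (2 * Real.pi)) :
    ∫ x in (0 : ℝ)..(2 * Real.pi), w x * deriv (deriv r) x
      = ∫ x in (0 : ℝ)..(2 * Real.pi), deriv (deriv w) x * r x := by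
  have hw' := contDiff_deriv hw
  have hr' := contDiff_deriv hr
  rw [integral_mul_deriv_of_periodic (hasDerivAt_of_contDiff hw) (hasDerivAt_of_contDiff hr')
      hw'.continuous (contDiff_deriv hr').continuous pw (periodic_deriv pr),
    integral_mul_deriv_of_periodic (hasDerivAt_of_contDiff hw') (hasDerivAt_of_contDiff hr)
      (contDiff_deriv hw').continuous hr'.continuous (periodic_deriv pw) pr, neg_neg]

theorem abs_two_mul_mul_le {a : ℝ} (ha : 0 < a) (x y : ℝ) :
    |2 * x * y| ≤ a * x ^ 2 + a⁻¹ * y ^ 2 := by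
  have h : a * a⁻¹ = 1 := mul_inv_cancel₀ ha.ne'
  have h1 : 0 ≤ a * (x + a⁻¹ * y) ^ 2 := by positivity
  have h2 : 0 ≤ a * (x - a⁻¹ * y) ^ 2 := by positivity
  have e1 : a * (x + a⁻¹ * y) ^ 2
      = a * x ^ 2 + 2 * (a * a⁻¹) * (x * y) + (a * a⁻¹) * a⁻¹ * y ^ 2 := by ring
  have e2 : a * (x - a⁻¹ * y) ^ 2
      = a * x ^ 2 - 2 * (a * a⁻¹) * (x * y) + (a * a⁻¹) * a⁻¹ * y ^ 2 := by ring
  rw [h] at e1 e2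
  exact abs_le.2 ⟨by linarith, by linarith⟩

/-- By Rolle, `w'` has a zero `z` in the period, so `w'(y)^2` is the integral of `2 w' w''` from `z`
to `y`. Young's inequality with parameter `a` finishes. -/
theorem sq_deriv_le {w : ℝ → ℝ} (hw : ContDiff ℝ ∞ w) (pw : Function.Periodic w (2 * Real.pi))
    {a : ℝ} (ha : 0 < a) (x : ℝ) :
    (deriv w x) ^ 2 ≤ a * (∫ y in (0 : ℝ)..(2 * Real.pi), (deriv w y) ^ 2)
      + a⁻¹ * ∫ y in (0 : ℝ)..(2 * Real.pi), (deriv (deriv w) y) ^ 2 := by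
  have hw' := contDiff_deriv hw
  have c1 : Continuous (deriv w) := hw'.continuous
  have c2 : Continuous (deriv (deriv w)) := (contDiff_deriv hw').continuous
  obtain ⟨z, hz, hwz⟩ := exists_hasDerivAt_eq_zero Real.two_pi_pos hw.continuous.continuousOn
    (by simpa using (pw 0).symm) fun x _ => hasDerivAt_of_contDiff hw x
  obtain ⟨y, hy, hxy⟩ := (periodic_deriv pw).exists_mem_Ico₀ Real.two_pi_pos x
  rw [hxy, ← intervalIntegral.integral_const_mul, ← intervalIntegral.integral_const_mul,
    ← intervalIntegral.integral_add (Continuous.intervalIntegrable (by fun_prop) _ _)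
      (Continuous.intervalIntegrable (by fun_prop) _ _)]
  have hd : ∀ s ∈ uIcc z y, HasDerivAt (fun s => (deriv w s) ^ 2)
      (2 * deriv w s * deriv (deriv w) s) s := by
    intro s _
    exact ((hasDerivAt_of_contDiff hw' s).pow 2).congr_deriv (by simp)
  have hftc := intervalIntegral.integral_eq_sub_of_hasDerivAt hd
    (((continuous_const.mul c1).mul c2).intervalIntegrable _ _)
  have h0 : (deriv w y) ^ 2 = ∫ s in z..y, 2 * deriv w s * deriv (deriv w) s := by
    rw [hftc, hwz]; ring
  have hb : ∀ s, |2 * deriv w s * deriv (deriv w) s|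
      ≤ a * deriv w s ^ 2 + a⁻¹ * deriv (deriv w) s ^ 2 := fun s =>
    abs_two_mul_mul_le ha _ _
  have ch : Continuous fun s => a * deriv w s ^ 2 + a⁻¹ * deriv (deriv w) s ^ 2 := by fun_prop
  calc deriv w y ^ 2 = ∫ s in z..y, 2 * deriv w s * deriv (deriv w) s := h0
    _ ≤ |∫ s in z..y, 2 * deriv w s * deriv (deriv w) s| := le_abs_self _
    _ ≤ |∫ s in z..y, (a * deriv w s ^ 2 + a⁻¹ * deriv (deriv w) s ^ 2)| := by
        rw [← Real.norm_eq_abs]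
        exact intervalIntegral.norm_integral_le_abs_of_norm_le
          (Eventually.of_forall fun s => hb s) (ch.intervalIntegrable _ _)
    _ ≤ |∫ s in (0 : ℝ)..(2 * Real.pi), (a * deriv w s ^ 2 + a⁻¹ * deriv (deriv w) s ^ 2)| := by
        refine intervalIntegral.abs_integral_mono_interval ?_
          (Eventually.of_forall fun s => by simp only [Pi.zero_apply]; positivity)
          (ch.intervalIntegrable _ _)
        rw [uIoc_of_le Real.two_pi_pos.le]
        exact Ioc_subset_Ioc (le_min hz.1.le hy.1) (max_le hz.2.le hy.2.le)
    _ = _ := abs_of_nonneg (intervalIntegral.integral_nonneg Real.two_pi_pos.le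
        fun s _ => by positivity)

/-- Integration by parts turns `∫ w'^2` into `-∫ w w''`, to which Young's inequality applies. -/
theorem integral_sq_deriv_le {w : ℝ → ℝ} (hw : ContDiff ℝ ∞ w)
    (pw : Function.Periodic w (2 * Real.pi)) {a : ℝ} (ha : 0 < a) :
    2 * ∫ y in (0 : ℝ)..(2 * Real.pi), (deriv w y) ^ 2
      ≤ a * (∫ y in (0 : ℝ)..(2 * Real.pi), (w y) ^ 2)
      + a⁻¹ * ∫ y in (0 : ℝ)..(2 * Real.pi), (deriv (deriv w) y) ^ 2 := by
  have hw' := contDiff_deriv hw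
  have c0 : Continuous w := hw.continuous
  have c1 : Continuous (deriv w) := hw'.continuous
  have c2 : Continuous (deriv (deriv w)) := (contDiff_deriv hw').continuous
  have h := integral_mul_deriv_of_periodic (hasDerivAt_of_contDiff hw)
    (hasDerivAt_of_contDiff hw') c1 c2 pw (periodic_deriv pw)
  have h1 : ∫ y in (0 : ℝ)..(2 * Real.pi), (deriv w y) ^ 2
      = ∫ y in (0 : ℝ)..(2 * Real.pi), -(w y * deriv (deriv w) y) := by
    rw [intervalIntegral.integral_neg, h, neg_neg]
    simp only [sq]
  rw [h1, ← intervalIntegral.integral_const_mul, ← intervalIntegral.integral_const_mul,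
    ← intervalIntegral.integral_const_mul,
    ← intervalIntegral.integral_add (Continuous.intervalIntegrable (by fun_prop) _ _)
      (Continuous.intervalIntegrable (by fun_prop) _ _)]
  refine intervalIntegral.integral_mono_on Real.two_pi_pos.le
    (Continuous.intervalIntegrable (by fun_prop) _ _)
    (Continuous.intervalIntegrable (by fun_prop) _ _) fun s _ => ?_
  linarith [neg_le_abs (2 * w s * deriv (deriv w) s),
    abs_two_mul_mul_le ha (w s) (deriv (deriv w) s)]

/-- The evolution of the `L²` distance of two solutions. -/
theorem hasDerivAt_integral_sq_sub {u₀ v₀ : ℝ → ℝ} {S T : EReal} {u v : ℝ → ℝ → ℝ}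
    (hu : IsRegularSolution u₀ S u) (hv : IsRegularSolution v₀ T v) {t : ℝ} (ht : 0 < t)
    (hS : (t : EReal) < S) (hT : (t : EReal) < T) :
    HasDerivAt (fun s => ∫ x in (0 : ℝ)..(2 * Real.pi), (u s x - v s x) ^ 2)
      (-2 * (∫ x in (0 : ℝ)..(2 * Real.pi), (deriv (deriv fun y => u t y - v t y) x) ^ 2)
        - 2 * ∫ x in (0 : ℝ)..(2 * Real.pi), deriv (deriv fun y => u t y - v t y) x
          * ((deriv (u t) x) ^ 2 - (deriv (v t) x) ^ 2)) t := by
  set U : Set ℝ := {t : ℝ | 0 < t ∧ (t : EReal) < S} ∩ {t : ℝ | 0 < t ∧ (t : EReal) < T} with hUdef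
  have hU : IsOpen U := (isOpen_timeDomain S).inter (isOpen_timeDomain T)
  have htU : t ∈ U := ⟨⟨ht, hS⟩, ht, hT⟩
  have su : ContDiffOn ℝ ∞ (fun p : ℝ × ℝ => u p.1 p.2) (U ×ˢ (univ : Set ℝ)) :=
    hu.smooth.mono (prod_mono inter_subset_left Subset.rfl)
  have sv : ContDiffOn ℝ ∞ (fun p : ℝ × ℝ => v p.1 p.2) (U ×ˢ (univ : Set ℝ)) :=
    hv.smooth.mono (prod_mono inter_subset_right Subset.rfl)
  refine (hasDerivAt_integral_of_contDiffOn (u := fun s x => (u s x - v s x) ^ 2) hU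
    ((su.sub sv).pow 2) htU).congr_deriv ?_
  have cu := contDiff_slice hU su htU
  have cv := contDiff_slice hU sv htU
  have pu := (hu.memH1 t ht.le hS).periodic
  have pv := (hv.memH1 t ht.le hT).periodic
  have cA : ∀ f : ℝ → ℝ, ContDiff ℝ ∞ f → ContDiff ℝ ∞ fun y => deriv (deriv f) y + deriv f y ^ 2 :=
    fun f hf => (contDiff_deriv (contDiff_deriv hf)).add ((contDiff_deriv hf).pow 2)
  have pA : ∀ f : ℝ → ℝ, Function.Periodic f (2 * Real.pi) →
      Function.Periodic (fun y => deriv (deriv f) y + deriv f y ^ 2) (2 * Real.pi) :=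
    fun f hf x => by
      simp only [periodic_deriv hf x, periodic_deriv (periodic_deriv hf) x]
  -- The right-hand side is put in the form `-(f_xx + (f_x)^2)_xx`, so that two integrations by
  -- parts move both outer derivatives onto `u - v`.
  have eq : ∀ f : ℝ → ℝ, ContDiff ℝ ∞ f → ∀ x,
      -iteratedDeriv 4 f x - iteratedDeriv 2 (fun y => deriv f y ^ 2) x
        = -deriv (deriv fun y => deriv (deriv f) y + deriv f y ^ 2) x := by
    intro f hf x
    rw [deriv_deriv_add (contDiff_deriv (contDiff_deriv hf)) ((contDiff_deriv hf).pow 2)]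
    simp only [iteratedDeriv_succ, iteratedDeriv_zero]
    ring
  have point : ∀ x, deriv (fun s => (u s x - v s x) ^ 2) t
      = -2 * ((u t x - v t x) * deriv (deriv fun y => (deriv (deriv (u t)) y + deriv (u t) y ^ 2)
        - (deriv (deriv (v t)) y + deriv (v t) y ^ 2)) x) := by
    intro x
    have du := (differentiableAt_time hU su htU x).hasDerivAt
    have dv := (differentiableAt_time hU sv htU x).hasDerivAt
    rw [hu.equation t ht hS x, eq _ cu] at du
    rw [hv.equation t ht hT x, eq _ cv] at dv
    have := ((du.sub dv).pow 2).deriv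
    rw [deriv_deriv_sub (cA _ cu) (cA _ cv)]
    simp only [Pi.sub_apply, Nat.cast_ofNat, Nat.add_one_sub_one, pow_one] at this
    refine Eq.trans this ?_
    ring
  simp only [point]
  have pw : Function.Periodic (fun y => u t y - v t y) (2 * Real.pi) := fun x => by
    simp only [pu x, pv x]
  rw [intervalIntegral.integral_const_mul,
    integral_mul_deriv_deriv (cu.sub cv) ((cA _ cu).sub (cA _ cv)) pw
      (fun x => by simp only [pA _ pu x, pA _ pv x]), deriv_deriv_sub cu cv,
    ← intervalIntegral.integral_const_mul, ← intervalIntegral.integral_const_mul,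
    ← intervalIntegral.integral_const_mul]
  have c1 := (contDiff_deriv cu).continuous
  have c2 := (contDiff_deriv cv).continuous
  have c3 := (contDiff_deriv (contDiff_deriv cu)).continuous
  have c4 := (contDiff_deriv (contDiff_deriv cv)).continuous
  rw [← intervalIntegral.integral_sub (Continuous.intervalIntegrable (by fun_prop) _ _)
      (Continuous.intervalIntegrable (by fun_prop) _ _)]
  exact intervalIntegral.integral_congr fun x _ => by ring

/-! ### Uniqueness -/

/-- For `w = u - v` and `p = u_x + v_x` the left side is the derivative of `‖w‖²`, since `u_x^2 -
v_x^2 = p w_x`. Young's inequality spends one `D` on the product and leaves `‖p‖²` times the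
supremum of `w_x^2`. The two interpolation inequalities, with parameters `2 N` and `2 N^2`, cost `D
/ 2` each, which exhausts the available `2 D`. -/
theorem energy_estimate {w p : ℝ → ℝ} (hw : ContDiff ℝ ∞ w)
    (pw : Function.Periodic w (2 * Real.pi)) (cp : Continuous p) {N : ℝ} (hN : 0 < N)
    (hp : ∫ x in (0 : ℝ)..(2 * Real.pi), (p x) ^ 2 ≤ N) :
    -2 * (∫ x in (0 : ℝ)..(2 * Real.pi), (deriv (deriv w) x) ^ 2)
        - 2 * ∫ x in (0 : ℝ)..(2 * Real.pi), deriv (deriv w) x * (p x * deriv w x)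
      ≤ 2 * N ^ 4 * ∫ x in (0 : ℝ)..(2 * Real.pi), (w x) ^ 2 := by
  have c0 := hw.continuous
  have c1 := (contDiff_deriv hw).continuous
  have c2 := (contDiff_deriv (contDiff_deriv hw)).continuous
  set E := ∫ x in (0 : ℝ)..(2 * Real.pi), (w x) ^ 2
  set P := ∫ x in (0 : ℝ)..(2 * Real.pi), (deriv w x) ^ 2 with hP
  set D := ∫ x in (0 : ℝ)..(2 * Real.pi), (deriv (deriv w) x) ^ 2 with hD
  have h1 : 2 * P ≤ 2 * N ^ 2 * E + (2 * N ^ 2)⁻¹ * D :=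
    integral_sq_deriv_le hw pw (by positivity)
  have h2 : ∀ x, deriv w x ^ 2 ≤ 2 * N * P + (2 * N)⁻¹ * D :=
    sq_deriv_le hw pw (by positivity)
  have hP0 : 0 ≤ P := intervalIntegral.integral_nonneg Real.two_pi_pos.le fun x _ => by positivity
  have hD0 : 0 ≤ D := intervalIntegral.integral_nonneg Real.two_pi_pos.le fun x _ => by positivity
  set B := 2 * N * P + (2 * N)⁻¹ * D with hB
  have hB0 : 0 ≤ B := by positivity
  have h3 : -2 * (∫ x in (0 : ℝ)..(2 * Real.pi), deriv (deriv w) x * (p x * deriv w x))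
      ≤ D + (∫ x in (0 : ℝ)..(2 * Real.pi), (p x) ^ 2) * B := by
    rw [hD, ← intervalIntegral.integral_const_mul, ← intervalIntegral.integral_mul_const,
      ← intervalIntegral.integral_add (Continuous.intervalIntegrable (by fun_prop) _ _)
        (Continuous.intervalIntegrable (by fun_prop) _ _)]
    refine intervalIntegral.integral_mono_on Real.two_pi_pos.le
      (Continuous.intervalIntegrable (by fun_prop) _ _)
      (Continuous.intervalIntegrable (by fun_prop) _ _) fun x _ => ?_
    have := mul_le_mul_of_nonneg_left (h2 x) (sq_nonneg (p x))
    nlinarith [sq_nonneg (deriv (deriv w) x + p x * deriv w x)]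
  have h4 : (∫ x in (0 : ℝ)..(2 * Real.pi), (p x) ^ 2) * B ≤ N * B :=
    mul_le_mul_of_nonneg_right hp hB0
  have h5 : N * B = 2 * N ^ 2 * P + D / 2 := by rw [hB]; field_simp
  have h6 : N ^ 2 * (2 * P) ≤ 2 * N ^ 4 * E + D / 2 := by
    calc N ^ 2 * (2 * P) ≤ N ^ 2 * (2 * N ^ 2 * E + (2 * N ^ 2)⁻¹ * D) := by gcongr
      _ = _ := by field_simp
  linarith

/-- Continuity into `H¹` gives local boundedness, and compactness of `[0, t₁]` makes it uniform.
This includes `t = 0`, where no smoothness is available. -/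
theorem IsRegularSolution.exists_h1Norm_le {u₀ : ℝ → ℝ} {S : EReal} {u : ℝ → ℝ → ℝ}
    (hu : IsRegularSolution u₀ S u) {t₁ : ℝ} (hS : (t₁ : EReal) < S) :
    ∃ C : ℝ≥0∞, C < ⊤ ∧ ∀ s ∈ Icc 0 t₁, h1Norm (u s) ≤ C := by
  have hlt : ∀ s ∈ Icc 0 t₁, (s : EReal) < S := fun s hs =>
    (EReal.coe_le_coe_iff.2 hs.2).trans_lt hS
  refine isCompact_Icc.induction_on (s := Icc 0 t₁)
    (p := fun A => ∃ C : ℝ≥0∞, C < ⊤ ∧ ∀ s ∈ A, h1Norm (u s) ≤ C) ⟨0, by simp, by simp⟩ ?_ ?_ ?_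
  · rintro A B hAB ⟨C, hC, h⟩
    exact ⟨C, hC, fun s hs => h s (hAB hs)⟩
  · rintro A B ⟨C, hC, h⟩ ⟨C', hC', h'⟩
    refine ⟨max C C', max_lt hC hC', ?_⟩
    rintro s (hs | hs)
    · exact (h s hs).trans (le_max_left _ _)
    · exact (h' s hs).trans (le_max_right _ _)
  · intro t ht
    have h1 := hu.continuous_h1 t ht.1 (hlt t ht)
    have h2 : ∀ᶠ s in 𝓝[Icc 0 t₁] t, h1Norm (u s - u t) < 1 :=
      (h1.mono_left (nhdsWithin_mono t fun s hs => ⟨hs.1, hlt s hs⟩)).eventually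
        (gt_mem_nhds one_pos)
    refine ⟨_, h2, 1 + h1Norm (u t), ?_, fun s hs => ?_⟩
    · exact ENNReal.add_lt_top.2 ⟨ENNReal.one_lt_top, (hu.memH1 t ht.1 (hlt t ht)).h1Norm_lt_top⟩
    · have : u s = (u s - u t) + u t := by simp
      rw [this]
      exact (h1Norm_add_le _ _).trans (add_le_add (le_of_lt hs) le_rfl)

theorem integral_sq_le_of_ofReal_sqrt_le {I : ℝ} (hI : 0 ≤ I) {C : ℝ≥0∞} (hC : C ≠ ⊤)
    (h : ENNReal.ofReal (Real.sqrt I) ≤ C) : I ≤ C.toReal ^ 2 := by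
  have := (ENNReal.ofReal_le_iff_le_toReal hC).1 h
  calc I = Real.sqrt I ^ 2 := (Real.sq_sqrt hI).symm
    _ ≤ _ := by gcongr

theorem IsRegularSolution.contDiff {u₀ : ℝ → ℝ} {S : EReal} {u : ℝ → ℝ → ℝ}
    (hu : IsRegularSolution u₀ S u) {t : ℝ} (ht : 0 < t) (hS : (t : EReal) < S) :
    ContDiff ℝ ∞ (u t) :=
  contDiff_slice (isOpen_timeDomain S) hu.smooth ⟨ht, hS⟩

theorem tendsto_integral_sq_of_h1Norm {w : ℝ → ℝ → ℝ} {l : Filter ℝ}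
    (hw : ∀ᶠ s in l, Continuous (w s) ∧ ∫ x in (0 : ℝ)..(2 * Real.pi), w s x = 0)
    (h : Tendsto (fun s => h1Norm (w s)) l (𝓝 0)) :
    Tendsto (fun s => ∫ x in (0 : ℝ)..(2 * Real.pi), (w s x) ^ 2) l (𝓝 0) := by
  have h1 : Tendsto (fun s => (h1Norm (w s)).toReal ^ 2) l (𝓝 0) := by
    simpa using ((ENNReal.tendsto_toReal ENNReal.zero_ne_top).comp h).pow 2
  refine tendsto_of_tendsto_of_tendsto_of_le_of_le' tendsto_const_nhds h1
    (Eventually.of_forall fun s =>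
      intervalIntegral.integral_nonneg Real.two_pi_pos.le fun x _ => by positivity) ?_
  filter_upwards [hw, h.eventually (gt_mem_nhds ENNReal.zero_lt_top)] with s hs hs'
  exact integral_sq_le_of_ofReal_sqrt_le
    (intervalIntegral.integral_nonneg Real.two_pi_pos.le fun x _ => by positivity) hs'.ne
    (sqrt_integral_sq_le_h1Norm hs.1 hs.2)

theorem eventually_mem_timeDomain {S : EReal} (hS : 0 < S) :
    ∀ᶠ s : ℝ in 𝓝[>] 0, 0 < s ∧ (s : EReal) < S := by
  have h1 : ∀ᶠ s : ℝ in 𝓝[>] 0, (s : EReal) < S :=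
    nhdsWithin_le_nhds ((continuous_coe_real_ereal.tendsto 0).eventually
      (gt_mem_nhds (by simpa using hS)))
  filter_upwards [h1, self_mem_nhdsWithin] with s hs h0 using ⟨h0, hs⟩

theorem IsRegularSolution.tendsto_h1Norm_zero {u₀ : ℝ → ℝ} {S : EReal} {u : ℝ → ℝ → ℝ}
    (hu : IsRegularSolution u₀ S u) (hS : 0 < S) :
    Tendsto (fun s => h1Norm (u s - u₀)) (𝓝[>] 0) (𝓝 0) := by
  have h := hu.continuous_h1 0 le_rfl (by simpa using hS)
  rw [hu.initial] at h
  refine h.mono_left (nhdsWithin_le_iff.2 ?_)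
  filter_upwards [eventually_mem_timeDomain hS] with s hs using ⟨hs.1.le, hs.2⟩

theorem integral_sub_eq_zero {f g : ℝ → ℝ} (hf : MemH1 f) (hg : MemH1 g) :
    ∫ x in (0 : ℝ)..(2 * Real.pi), (f - g) x = 0 := by
  simp only [Pi.sub_apply]
  rw [intervalIntegral.integral_sub (hf.continuous.intervalIntegrable _ _)
    (hg.continuous.intervalIntegrable _ _), hf.mean_zero, hg.mean_zero, sub_zero]

theorem eq_of_integral_sq_sub_nonpos {f g : ℝ → ℝ} (cf : Continuous f) (cg : Continuous g)
    (pf : Function.Periodic f (2 * Real.pi)) (pg : Function.Periodic g (2 * Real.pi))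
    (h : ∫ x in (0 : ℝ)..(2 * Real.pi), (f x - g x) ^ 2 ≤ 0) : f = g := by
  have hc : Continuous fun x => (f x - g x) ^ 2 := by fun_prop
  have h0 : ∀ x ∈ Icc (0 : ℝ) (2 * Real.pi), (f x - g x) ^ 2 = 0 := by
    intro x hx
    by_contra hne
    have hpos : 0 < ∫ x in (0 : ℝ)..(2 * Real.pi), (f x - g x) ^ 2 :=
      intervalIntegral.integral_pos Real.two_pi_pos hc.continuousOn (fun y _ => sq_nonneg _)
        ⟨x, hx, lt_of_le_of_ne (sq_nonneg _) (Ne.symm hne)⟩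
    exact absurd h (not_le.2 hpos)
  have hp : Function.Periodic (fun x => f x - g x) (2 * Real.pi) := fun x => by
    simp only [pf x, pg x]
  funext x
  obtain ⟨y, hy, hxy⟩ := hp.exists_mem_Ico₀ Real.two_pi_pos x
  have := pow_eq_zero_iff (two_ne_zero) |>.1 (h0 y (Ico_subset_Icc_self hy))
  linarith

/-- Regular solutions are determined by their initial value. -/
theorem IsRegularSolution.eq {u₀ : ℝ → ℝ} {S T : EReal} {u v : ℝ → ℝ → ℝ}
    (hu : IsRegularSolution u₀ S u) (hv : IsRegularSolution u₀ T v) {t : ℝ} (ht : 0 ≤ t)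
    (hS : (t : EReal) < S) (hT : (t : EReal) < T) : u t = v t := by
  rcases ht.eq_or_lt with rfl | ht0
  · rw [hu.initial, hv.initial]
  have hlt : ∀ s ≤ t, (s : EReal) < S ∧ (s : EReal) < T := fun s hs =>
    ⟨(EReal.coe_le_coe_iff.2 hs).trans_lt hS, (EReal.coe_le_coe_iff.2 hs).trans_lt hT⟩
  have hS0 : 0 < S := by simpa using (hlt 0 ht).1
  have hT0 : 0 < T := by simpa using (hlt 0 ht).2
  obtain ⟨C₁, hC₁, hb₁⟩ := hu.exists_h1Norm_le hS
  obtain ⟨C₂, hC₂, hb₂⟩ := hv.exists_h1Norm_le hT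
  -- This bounds `∫ (u_x + v_x)^2` on `(0, t]`; the added `1` only ensures positivity.
  set N : ℝ := 2 * C₁.toReal ^ 2 + 2 * C₂.toReal ^ 2 + 1 with hN
  have hN0 : 0 < N := by positivity
  set E : ℝ → ℝ := fun s => ∫ x in (0 : ℝ)..(2 * Real.pi), (u s x - v s x) ^ 2 with hE
  have hmain : ∀ s ∈ Ioc 0 t, ∃ E', HasDerivAt E E' s ∧ E' ≤ 2 * N ^ 4 * E s := by
    intro s hs
    have hs' := hlt s hs.2
    refine ⟨_, hasDerivAt_integral_sq_sub hu hv hs.1 hs'.1 hs'.2, ?_⟩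
    have cu := hu.contDiff hs.1 hs'.1
    have cv := hv.contDiff hs.1 hs'.2
    have mu := hu.memH1 s hs.1.le hs'.1
    have mv := hv.memH1 s hs.1.le hs'.2
    have cu' := (contDiff_deriv cu).continuous
    have cv' := (contDiff_deriv cv).continuous
    have b1 := integral_sq_le_of_ofReal_sqrt_le
      (intervalIntegral.integral_nonneg Real.two_pi_pos.le fun x _ => sq_nonneg (deriv (u s) x))
      hC₁.ne ((le_h1Norm_of_contDiff cu mu.periodic).trans (hb₁ s (Ioc_subset_Icc_self hs)))
    have b2 := integral_sq_le_of_ofReal_sqrt_le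
      (intervalIntegral.integral_nonneg Real.two_pi_pos.le fun x _ => sq_nonneg (deriv (v s) x))
      hC₂.ne ((le_h1Norm_of_contDiff cv mv.periodic).trans (hb₂ s (Ioc_subset_Icc_self hs)))
    have b3 : ∫ x in (0 : ℝ)..(2 * Real.pi), (deriv (u s) x + deriv (v s) x) ^ 2 ≤ N := by
      have : ∫ x in (0 : ℝ)..(2 * Real.pi), (deriv (u s) x + deriv (v s) x) ^ 2
          ≤ ∫ x in (0 : ℝ)..(2 * Real.pi), (2 * deriv (u s) x ^ 2 + 2 * deriv (v s) x ^ 2) :=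
        intervalIntegral.integral_mono_on Real.two_pi_pos.le
          (Continuous.intervalIntegrable (by fun_prop) _ _)
          (Continuous.intervalIntegrable (by fun_prop) _ _) fun x _ => by
            nlinarith [sq_nonneg (deriv (u s) x - deriv (v s) x)]
      rw [intervalIntegral.integral_add (Continuous.intervalIntegrable (by fun_prop) _ _)
        (Continuous.intervalIntegrable (by fun_prop) _ _), intervalIntegral.integral_const_mul,
        intervalIntegral.integral_const_mul] at this
      linarith
    have hest := energy_estimate (cu.sub cv) (p := fun x => deriv (u s) x + deriv (v s) x)
      (fun x => by simp only [mu.periodic x, mv.periodic x]) (by fun_prop) hN0 b3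
    have hd : deriv (fun y => u s y - v s y) = fun y => deriv (u s) y - deriv (v s) y :=
      funext fun y => ((hasDerivAt_of_contDiff cu y).sub (hasDerivAt_of_contDiff cv y)).deriv
    refine le_trans (le_of_eq ?_) hest
    congr 2
    refine intervalIntegral.integral_congr fun x _ => ?_
    simp only [hd]
    ring
  have hlim : Tendsto E (𝓝[>] 0) (𝓝 0) := by
    refine tendsto_integral_sq_of_h1Norm (w := fun s => u s - v s) ?_ ?_
    · filter_upwards [eventually_mem_timeDomain hS0, eventually_mem_timeDomain hT0] with s h1 h2
      have mu := hu.memH1 s h1.1.le h1.2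
      have mv := hv.memH1 s h2.1.le h2.2
      exact ⟨mu.continuous.sub mv.continuous, integral_sub_eq_zero mu mv⟩
    · have h := (hu.tendsto_h1Norm_zero hS0).add (hv.tendsto_h1Norm_zero hT0)
      rw [add_zero] at h
      refine tendsto_of_tendsto_of_tendsto_of_le_of_le tendsto_const_nhds h
        (fun s => zero_le) fun s => ?_
      have : u s - v s = (u s - u₀) - (v s - u₀) := by simp
      simp only [this]
      exact h1Norm_sub_le _ _
  -- Gronwall by an integrating factor. The equation holds only for positive times, so monotonicity
  -- on `(0, t]` is combined with the limit of `F` at `0+` rather than with a value at `0`.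
  set F : ℝ → ℝ := fun s => E s * Real.exp (-(2 * N ^ 4) * s) with hF
  have hFd : ∀ s ∈ Ioc 0 t, ∃ F', HasDerivAt F F' s ∧ F' ≤ 0 := by
    intro s hs
    obtain ⟨E', h1, h2⟩ := hmain s hs
    have h3 : HasDerivAt (fun s => Real.exp (-(2 * N ^ 4) * s))
        (Real.exp (-(2 * N ^ 4) * s) * (-(2 * N ^ 4) * 1)) s :=
      ((hasDerivAt_id s).const_mul _).exp
    refine ⟨_, h1.mul h3, ?_⟩
    have := mul_le_mul_of_nonneg_right h2 (Real.exp_pos (-(2 * N ^ 4) * s)).le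
    linarith
  have hanti : AntitoneOn F (Ioc 0 t) := by
    refine antitoneOn_of_deriv_nonpos (convex_Ioc 0 t) ?_ ?_ ?_
    · intro s hs
      obtain ⟨F', h1, -⟩ := hFd s hs
      exact h1.continuousAt.continuousWithinAt
    · intro s hs
      obtain ⟨F', h1, -⟩ := hFd s (interior_subset hs)
      exact h1.differentiableAt.differentiableWithinAt
    · intro s hs
      obtain ⟨F', h1, h2⟩ := hFd s (interior_subset hs)
      rw [h1.deriv]
      exact h2
  have hFlim : Tendsto F (𝓝[>] 0) (𝓝 0) := by
    have h3 : Tendsto (fun s => Real.exp (-(2 * N ^ 4) * s)) (𝓝[>] 0)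
        (𝓝 (Real.exp (-(2 * N ^ 4) * 0))) :=
      (Continuous.tendsto (by fun_prop) 0).mono_left nhdsWithin_le_nhds
    simpa only [zero_mul] using hlim.mul h3
  have hFt : F t ≤ 0 := by
    refine ge_of_tendsto hFlim ?_
    filter_upwards [Ioc_mem_nhdsGT ht0] with s hs
    exact hanti hs ⟨ht0, le_rfl⟩ hs.2
  have hEt : E t ≤ 0 := nonpos_of_mul_nonpos_left hFt (Real.exp_pos _)
  have mu := hu.memH1 t ht hS
  have mv := hv.memH1 t ht hT
  exact eq_of_integral_sq_sub_nonpos mu.continuous mv.continuous mu.periodic mv.periodic hEt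

/-! ### Energy dissipation -/

theorem memH1_zero : MemH1 0 where
  continuous := continuous_const
  periodic := fun x => rfl
  mean_zero := by simp
  h1Norm_lt_top := (h1Norm_le_of_hasDerivAt (f := 0) (g := 0) (fun x => hasDerivAt_const x 0)
    continuous_const (fun x => rfl)).trans_lt ENNReal.ofReal_lt_top

/-- Comparison with the zero solution turns the balance for two solutions into the energy identity;
it also settles zero initial data. -/
theorem isRegularSolution_zero (T : EReal) : IsRegularSolution 0 T 0 where
  initial := rfl
  memH1 := fun t _ _ => memH1_zero
  continuous_h1 := fun t _ _ => by
    have : h1Norm 0 = 0 := le_antisymm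
      ((h1Norm_le_of_hasDerivAt (f := 0) (g := 0) (fun x => hasDerivAt_const x 0)
        continuous_const (fun x => rfl)).trans (by simp)) zero_le
    simpa [this] using tendsto_const_nhds
  smooth := contDiffOn_const
  equation := fun t _ _ x => by
    have h : (0 : ℝ → ℝ → ℝ) t = fun _ => 0 := rfl
    have h2 : (fun y => deriv ((0 : ℝ → ℝ → ℝ) t) y ^ 2) = fun _ => 0 := by
      funext y; simp
    rw [h2, h]
    simp

/-- The energy identity. -/
theorem IsRegularSolution.hasDerivAt_integral_sq {u₀ : ℝ → ℝ} {S : EReal} {u : ℝ → ℝ → ℝ}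
    (hu : IsRegularSolution u₀ S u) {t : ℝ} (ht : 0 < t) (hS : (t : EReal) < S) :
    HasDerivAt (fun s => ∫ x in (0 : ℝ)..(2 * Real.pi), (u s x) ^ 2)
      (-2 * ∫ x in (0 : ℝ)..(2 * Real.pi), (deriv (deriv (u t)) x) ^ 2) t := by
  have h := hasDerivAt_integral_sq_sub hu (isRegularSolution_zero ⊤) ht hS (EReal.coe_lt_top t)
  have h0 : deriv (0 : ℝ → ℝ) = fun _ => 0 := by
    funext x
    exact deriv_const x (0 : ℝ)
  simp only [Pi.zero_apply, sub_zero, h0] at h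
  refine h.congr_deriv ?_
  have cu := hu.contDiff ht hS
  have cu' := contDiff_deriv cu
  -- The cubic term is the derivative of the periodic function `(u_x)^3`.
  have hz : ∫ x in (0 : ℝ)..(2 * Real.pi), 3 * (deriv (deriv (u t)) x * deriv (u t) x ^ 2) = 0 := by
    refine integral_deriv_of_periodic (f := fun x => deriv (u t) x ^ 3) (fun x => ?_) ?_ ?_
    · exact ((hasDerivAt_of_contDiff cu' x).pow 3).congr_deriv (by norm_num; ring)
    · have := cu'.continuous
      have := (contDiff_deriv cu').continuous
      fun_prop
    · intro x
      simp only [periodic_deriv (hu.memH1 t ht.le hS).periodic x]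
  rw [intervalIntegral.integral_const_mul] at hz
  have h2 : (0 : ℝ) ^ 2 = 0 := by norm_num
  simp only [h2, sub_zero]
  linarith

/-- Before the critical time the second derivative becomes small. -/
theorem exists_integral_sq_deriv_deriv_le {u₀ : ℝ → ℝ} (hu₀ : MemH1 u₀) {u : ℝ → ℝ → ℝ}
    (hu : IsRegularSolution u₀ (criticalTime u₀ : EReal) u) (hpos : 0 < criticalTime u₀) :
    ∃ t, 0 < t ∧ t < criticalTime u₀ ∧
      ∫ x in (0 : ℝ)..(2 * Real.pi), (deriv (deriv (u t)) x) ^ 2 ≤ 1 / 7 := by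
  by_contra! hcon
  set T := criticalTime u₀ with hT
  set E : ℝ → ℝ := fun s => ∫ x in (0 : ℝ)..(2 * Real.pi), (u s x) ^ 2 with hE
  set E₀ := ∫ x in (0 : ℝ)..(2 * Real.pi), (u₀ x) ^ 2 with hE₀
  have hTE : T = 4 * E₀ := rfl
  have hd : ∀ s ∈ Ioo 0 T, HasDerivAt (fun s => E s + 2 / 7 * s)
      (-2 * (∫ x in (0 : ℝ)..(2 * Real.pi), (deriv (deriv (u s)) x) ^ 2) + 2 / 7 * 1) s :=
    fun s hs => (hu.hasDerivAt_integral_sq hs.1 (EReal.coe_lt_coe_iff.2 hs.2)).add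
      ((hasDerivAt_id s).const_mul _)
  have hanti : AntitoneOn (fun s => E s + 2 / 7 * s) (Ioo 0 T) := by
    refine antitoneOn_of_deriv_nonpos (convex_Ioo 0 T)
      (fun s hs => (hd s hs).continuousAt.continuousWithinAt)
      (fun s hs => (hd s (interior_subset hs)).differentiableAt.differentiableWithinAt)
      fun s hs => ?_
    have hs' := interior_subset hs
    rw [(hd s hs').deriv]
    linarith [hcon s hs'.1 hs'.2]
  have hT0 : (0 : EReal) < (T : EReal) := by exact_mod_cast hpos
  have hlim : Tendsto (fun s => ∫ x in (0 : ℝ)..(2 * Real.pi), ((u s - u₀) x) ^ 2)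
      (𝓝[>] 0) (𝓝 0) := by
    refine tendsto_integral_sq_of_h1Norm ?_ (hu.tendsto_h1Norm_zero hT0)
    filter_upwards [eventually_mem_timeDomain hT0] with s h1
    have mu := hu.memH1 s h1.1.le h1.2
    exact ⟨mu.continuous.sub hu₀.continuous, integral_sub_eq_zero mu hu₀⟩
  -- Young's inequality `(y + d)^2 ≤ (1 + 1/28) y^2 + (1 + 28) d^2`. Letting `s → 0+` bounds the
  -- initial energy by `29/28 * E₀`, which is sharp enough below.
  have hbound : ∀ᶠ s in 𝓝[>] (0 : ℝ), E s ≤ 29 / 28 * E₀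
      + 29 * ∫ x in (0 : ℝ)..(2 * Real.pi), ((u s - u₀) x) ^ 2 := by
    filter_upwards [eventually_mem_timeDomain hT0] with s h1
    have mu := (hu.memH1 s h1.1.le h1.2).continuous
    have mu0 := hu₀.continuous
    simp only [Pi.sub_apply, hE, hE₀]
    rw [← intervalIntegral.integral_const_mul, ← intervalIntegral.integral_const_mul,
      ← intervalIntegral.integral_add (Continuous.intervalIntegrable (by fun_prop) _ _)
      (Continuous.intervalIntegrable (by fun_prop) _ _)]
    refine intervalIntegral.integral_mono_on Real.two_pi_pos.le
      (Continuous.intervalIntegrable (by fun_prop) _ _)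
      (Continuous.intervalIntegrable (by fun_prop) _ _) fun x _ => ?_
    nlinarith [sq_nonneg (u₀ x - 28 * (u s x - u₀ x))]
  -- By this time the energy loss would be at least `2/7 * 15/16 * 4 * E₀ = 30/28 * E₀`, exceeding
  -- `29/28 * E₀`.
  have ht₁ : 15 / 16 * T ∈ Ioo 0 T := ⟨by linarith, by linarith⟩
  have hle : E (15 / 16 * T) + 2 / 7 * (15 / 16 * T) ≤ 29 / 28 * E₀ + 29 * 0 + 2 / 7 * 0 := by
    have hid : Tendsto (fun s : ℝ => 2 / 7 * s) (𝓝[>] 0) (𝓝 (2 / 7 * 0)) :=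
      (Continuous.tendsto (by fun_prop) 0).mono_left nhdsWithin_le_nhds
    refine ge_of_tendsto (((hlim.const_mul 29).const_add (29 / 28 * E₀)).add hid) ?_
    filter_upwards [Ioc_mem_nhdsGT ht₁.1, hbound] with s hs hb
    have := hanti ⟨hs.1, hs.2.trans_lt ht₁.2⟩ ht₁ hs.2
    simp only at this
    linarith
  have hE1 : 0 ≤ E (15 / 16 * T) :=
    intervalIntegral.integral_nonneg Real.two_pi_pos.le fun x _ => by positivity
  linarith

/-! ### Convolutions on `ℤ` -/

theorem hasSum_of_eq {f g : ℤ → ℂ} {a : ℂ} (h : HasSum g a) (hfg : ∀ k, f k = g k) :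
    HasSum f a := by
  rwa [funext hfg]

/-- The absolutely convergent double sum is rearranged along the antidiagonals `j + l = k`. -/
theorem hasSum_conv {f g : ℤ → ℂ} (hf : Summable fun k => ‖f k‖) (hg : Summable fun k => ‖g k‖) :
    (∀ k, Summable fun j => f j * g (k - j)) ∧
      HasSum (fun k => ∑' j, f j * g (k - j)) ((∑' k, f k) * ∑' k, g k) := by
  let e : ℤ × ℤ ≃ ℤ × ℤ :=
    { toFun := fun p => (p.2, p.1 - p.2)
      invFun := fun p => (p.1 + p.2, p.1)
      left_inv := fun p => by simp
      right_inv := fun p => by simp }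
  have h : Summable fun p : ℤ × ℤ => f p.1 * g p.2 := summable_mul_of_summable_norm hf hg
  have h1 : HasSum (fun p : ℤ × ℤ => f p.1 * g p.2) ((∑' k, f k) * ∑' k, g k) := by
    rw [tsum_mul_tsum_of_summable_norm hf hg]
    exact h.hasSum
  have h2 := (e.hasSum_iff (f := fun p : ℤ × ℤ => f p.1 * g p.2)).2 h1
  have h3 : ∀ k, Summable fun j => f j * g (k - j) := fun k => h2.summable.prod_factor k
  exact ⟨h3, h2.prod_fiberwise fun k => (h3 k).hasSum⟩

/-- Since `|k|` is at most `|j| + |k - j|`, the weight can be placed on one factor, which is then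
bounded by `C`, while the other factor is summed. Polynomial decay thus survives convolution. -/
theorem summable_conv_and_pow_mul_le {a : ℤ → ℝ} (h0 : ∀ k, 0 ≤ a k) (hs : Summable a) {A : ℝ}
    (hA : ∑' k, a k ≤ A) {n : ℕ} {C : ℝ} (hC : ∀ k : ℤ, |(k : ℝ)| ^ n * a k ≤ C) (k : ℤ) :
    (Summable fun j => a j * a (k - j)) ∧
      |(k : ℝ)| ^ n * ∑' j, a j * a (k - j) ≤ 2 ^ n * (2 * C * A) := by
  have hC0 : 0 ≤ C := (mul_nonneg (by positivity) (h0 0)).trans (hC 0)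
  have hs' : Summable fun j => a (k - j) := (Equiv.subLeft k).summable_iff.2 hs
  have hts : ∑' j, a (k - j) = ∑' j, a j := (Equiv.subLeft k).tsum_eq a
  have hle : ∀ j, a j ≤ A := fun j => (hs.le_tsum j fun i _ => h0 i).trans hA
  have hsum : Summable fun j => a j * a (k - j) :=
    Summable.of_nonneg_of_le (fun j => mul_nonneg (h0 _) (h0 _))
      (fun j => mul_le_mul_of_nonneg_left (hle _) (h0 j)) (hs.mul_right A)
  refine ⟨hsum, ?_⟩
  have hpt : ∀ j, |(k : ℝ)| ^ n * (a j * a (k - j)) ≤ 2 ^ n * C * (a (k - j) + a j) := by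
    intro j
    have h1 : |(k : ℝ)| ^ n ≤ 2 ^ n * (|(j : ℝ)| ^ n + |((k - j : ℤ) : ℝ)| ^ n) := by
      have : |(k : ℝ)| ≤ |(j : ℝ)| + |((k - j : ℤ) : ℝ)| := by
        have := abs_add_le (j : ℝ) ((k - j : ℤ) : ℝ)
        push_cast at this ⊢
        simpa using this
      calc |(k : ℝ)| ^ n ≤ (|(j : ℝ)| + |((k - j : ℤ) : ℝ)|) ^ n := by gcongr
        _ ≤ 2 ^ (n - 1) * (|(j : ℝ)| ^ n + |((k - j : ℤ) : ℝ)| ^ n) :=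
          add_pow_le (abs_nonneg _) (abs_nonneg _) n
        _ ≤ _ := by
          gcongr
          · norm_num
          · omega
    have h2 := mul_le_mul_of_nonneg_right (hC j) (h0 (k - j))
    have h3 := mul_le_mul_of_nonneg_right (hC (k - j)) (h0 j)
    calc |(k : ℝ)| ^ n * (a j * a (k - j))
        ≤ 2 ^ n * (|(j : ℝ)| ^ n + |((k - j : ℤ) : ℝ)| ^ n) * (a j * a (k - j)) :=
          mul_le_mul_of_nonneg_right h1 (mul_nonneg (h0 _) (h0 _))
      _ = 2 ^ n * (|(j : ℝ)| ^ n * a j * a (k - j)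
          + |((k - j : ℤ) : ℝ)| ^ n * a (k - j) * a j) := by ring
      _ ≤ 2 ^ n * (C * a (k - j) + C * a j) := by gcongr
      _ = _ := by ring
  rw [← tsum_mul_left]
  calc ∑' j, |(k : ℝ)| ^ n * (a j * a (k - j)) ≤ ∑' j, 2 ^ n * C * (a (k - j) + a j) :=
        (hsum.mul_left _).tsum_le_tsum hpt ((hs'.add hs).mul_left _)
    _ = 2 ^ n * (2 * C * ∑' j, a j) := by
        rw [tsum_mul_left, hs'.tsum_add hs, hts]; ring
    _ ≤ _ := by gcongr

/-! ### Solutions given by their Fourier coefficients -/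

/-- A family of rapidly decreasing Fourier coefficients which solves the surface growth equation
in Fourier variables. -/
structure IsFourierSolution (c : ℤ → ℝ → ℂ) : Prop where
  continuous : ∀ k, Continuous (c k)
  decay : ∀ m : ℕ, ∃ C : ℝ, ∀ (k : ℤ) t, |(k : ℝ)| ^ m * ‖c k t‖ ≤ C
  mean_zero : ∀ t, c 0 t = 0
  conj : ∀ k t, (starRingEnd ℂ) (c k t) = c (-k) t
  equation : ∀ k t, 0 < t → HasDerivAt (c k)
    (-(k : ℂ) ^ 4 * c k t
      - (k : ℂ) ^ 2 * ∑' j : ℤ, (j * c j t) * (((k - j : ℤ) : ℂ) * c (k - j) t)) t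

/-- The `m`-th spatial derivative of the Fourier series with coefficients `c`. -/
def fourierSeries (c : ℤ → ℝ → ℂ) (m : ℕ) (t x : ℝ) : ℂ :=
  ∑' k : ℤ, (Complex.I * k) ^ m * c k t * character k x

theorem norm_I_mul_pow (k : ℤ) (m : ℕ) : ‖(Complex.I * k : ℂ) ^ m‖ = |(k : ℝ)| ^ m := by
  simp [norm_pow]

namespace IsFourierSolution

variable {c : ℤ → ℝ → ℂ}

/-- Two spare powers of decay give a multiple of `1 / k^2`; at `k = 0` this is `0` by convention,
and `mean_zero` covers it. The bound is uniform in time, which justifies all termwise operations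
below. -/
theorem summable_bound (hc : IsFourierSolution c) (m : ℕ) :
    ∃ u : ℤ → ℝ, Summable u ∧ ∀ (k : ℤ) t, |(k : ℝ)| ^ m * ‖c k t‖ ≤ u k := by
  obtain ⟨C, hC⟩ := hc.decay (m + 2)
  refine ⟨fun k => C * (1 / (k : ℝ) ^ 2), (Real.summable_one_div_int_pow.2 one_lt_two).mul_left C,
    fun k t => ?_⟩
  rcases eq_or_ne k 0 with rfl | hk
  · simp [hc.mean_zero]
  · have hk' : 0 < (k : ℝ) ^ 2 := by positivity
    change _ ≤ C * (1 / (k : ℝ) ^ 2)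
    rw [mul_one_div, le_div_iff₀ hk', ← sq_abs (k : ℝ)]
    calc |(k : ℝ)| ^ m * ‖c k t‖ * |(k : ℝ)| ^ 2 = |(k : ℝ)| ^ (m + 2) * ‖c k t‖ := by ring
      _ ≤ C := hC k t

theorem summable_norm (hc : IsFourierSolution c) (m : ℕ) (t x : ℝ) :
    Summable fun k : ℤ => ‖(Complex.I * k) ^ m * c k t * character k x‖ := by
  obtain ⟨u, hu, hb⟩ := hc.summable_bound m
  refine Summable.of_nonneg_of_le (fun k => norm_nonneg _) (fun k => ?_) hu
  rw [norm_mul, norm_mul, norm_I_mul_pow, norm_character, mul_one]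
  exact hb k t

theorem hasDerivAt_space (hc : IsFourierSolution c) (m : ℕ) (t x : ℝ) :
    HasDerivAt (fourierSeries c m t) (fourierSeries c (m + 1) t x) x := by
  obtain ⟨u, hu, hb⟩ := hc.summable_bound (m + 1)
  refine hasDerivAt_tsum (g := fun (k : ℤ) x => (Complex.I * k) ^ m * c k t * character k x)
    (g' := fun (k : ℤ) x => (Complex.I * k) ^ (m + 1) * c k t * character k x) hu ?_ ?_
    (hc.summable_norm m t 0).of_norm x
  · intro k y
    exact ((hasDerivAt_character k y).const_mul _).congr_deriv (by ring)
  · intro k y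
    rw [norm_mul, norm_mul, norm_I_mul_pow, norm_character, mul_one]
    exact hb k t

/-- The quadratic term in Fourier variables. -/
theorem nonlinearity_bound (hc : IsFourierSolution c) (m : ℕ) :
    ∃ C : ℝ, ∀ (k : ℤ) t,
      |(k : ℝ)| ^ m * ‖∑' j : ℤ, (j * c j t) * (((k - j : ℤ) : ℂ) * c (k - j) t)‖ ≤ C := by
  obtain ⟨u, hu, hb⟩ := hc.summable_bound 1
  obtain ⟨C, hC⟩ := hc.decay (m + 1)
  refine ⟨2 ^ m * (2 * C * ∑' k, u k), fun k t => ?_⟩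
  simp only [pow_one] at hb
  have hs : Summable fun k : ℤ => |(k : ℝ)| * ‖c k t‖ :=
    Summable.of_nonneg_of_le (fun k => by positivity) (fun k => hb k t) hu
  have h := summable_conv_and_pow_mul_le (a := fun k : ℤ => |(k : ℝ)| * ‖c k t‖)
    (fun k => by positivity) hs (hs.tsum_le_tsum (fun k => hb k t) hu) (n := m) (C := C)
    (fun k => by
      calc _ = |(k : ℝ)| ^ (m + 1) * ‖c k t‖ := by ring
        _ ≤ C := hC k t) k
  refine le_trans ?_ h.2
  gcongr
  refine (norm_tsum_le_tsum_norm ?_).trans_eq ?_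
  · refine h.1.congr fun j => ?_
    rw [norm_mul, norm_mul, norm_mul, Complex.norm_intCast, Complex.norm_intCast]
  · refine tsum_congr fun j => ?_
    rw [norm_mul, norm_mul, norm_mul, Complex.norm_intCast, Complex.norm_intCast]

/-- This is the Leibniz rule for the `m`-th derivative of `(u_x)^2`: on the Fourier side it is the
binomial expansion of `(ij + il)^m` with `j + l = k`. The minus sign comes from `(ij)(il) = -jl`. -/
theorem hasSum_nonlinearity (hc : IsFourierSolution c) (m : ℕ) (t x : ℝ) :
    HasSum (fun k : ℤ => (Complex.I * k) ^ m *
        (-∑' j : ℤ, (j * c j t) * (((k - j : ℤ) : ℂ) * c (k - j) t)) * character k x)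
      (∑ i ∈ Finset.range (m + 1), (m.choose i : ℂ)
        * (fourierSeries c (1 + i) t x * fourierSeries c (1 + (m - i)) t x)) := by
  have hconv := fun i => hasSum_conv (hc.summable_norm (1 + i) t x)
    (hc.summable_norm (1 + (m - i)) t x)
  have h := hasSum_sum (s := Finset.range (m + 1)) fun i _ =>
    (hconv i).2.mul_left (m.choose i : ℂ)
  refine hasSum_of_eq h fun k => ?_
  simp_rw [← tsum_mul_left]
  rw [← Summable.tsum_finsetSum fun i _ => ((hconv i).1 k).mul_left _, ← tsum_neg,
    ← tsum_mul_left, ← tsum_mul_right]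
  refine tsum_congr fun j => ?_
  obtain ⟨l, rfl⟩ : ∃ l, k = j + l := ⟨k - j, by ring⟩
  rw [add_sub_cancel_left, character_add, Int.cast_add, mul_add, add_pow, Finset.sum_mul,
    Finset.sum_mul]
  refine Finset.sum_congr rfl fun i _ => ?_
  rw [pow_add _ 1 i, pow_add _ 1 (m - i)]
  linear_combination ((Complex.I * j) ^ i * (Complex.I * l) ^ (m - i) * (m.choose i : ℂ)
    * (j * c j t) * (l * c l t) * character j x * character l x) * (-Complex.I_sq)

/-- Packages what termwise differentiation in time needs: coefficient derivatives, a time-uniform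
summable bound on them, and the value of the differentiated series. -/
theorem exists_derivative (hc : IsFourierSolution c) (m : ℕ) :
    ∃ d : ℤ → ℝ → ℂ, (∀ k t, 0 < t → HasDerivAt (c k) (d k t) t) ∧
      (∃ u : ℤ → ℝ, Summable u ∧ ∀ (k : ℤ) t, |(k : ℝ)| ^ m * ‖d k t‖ ≤ u k) ∧
      ∀ t x, HasSum (fun k : ℤ => (Complex.I * k) ^ m * d k t * character k x)
        (-fourierSeries c (m + 4) t x - ∑ i ∈ Finset.range (m + 3), ((m + 2).choose i : ℂ)
          * (fourierSeries c (1 + i) t x * fourierSeries c (1 + (m + 2 - i)) t x)) := by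
  refine ⟨_, hc.equation, ?_, fun t x => ?_⟩
  · obtain ⟨u, hu, hb⟩ := hc.summable_bound (m + 4)
    obtain ⟨C, hC⟩ := hc.nonlinearity_bound (m + 4)
    refine ⟨fun k => u k + C * (1 / (k : ℝ) ^ 2),
      hu.add ((Real.summable_one_div_int_pow.2 one_lt_two).mul_left C), fun k t => ?_⟩
    set N := ∑' j : ℤ, (j * c j t) * (((k - j : ℤ) : ℂ) * c (k - j) t)
    have h1 : ‖-(k : ℂ) ^ 4 * c k t - (k : ℂ) ^ 2 * N‖
        ≤ |(k : ℝ)| ^ 4 * ‖c k t‖ + |(k : ℝ)| ^ 2 * ‖N‖ :=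
      (norm_sub_le _ _).trans_eq (by simp [norm_pow])
    have h2 : |(k : ℝ)| ^ (m + 2) * ‖N‖ ≤ C * (1 / (k : ℝ) ^ 2) := by
      rcases eq_or_ne k 0 with rfl | hk
      · simp
      · have hk' : 0 < (k : ℝ) ^ 2 := by positivity
        rw [mul_one_div, le_div_iff₀ hk', ← sq_abs (k : ℝ)]
        calc |(k : ℝ)| ^ (m + 2) * ‖N‖ * |(k : ℝ)| ^ 2 = |(k : ℝ)| ^ (m + 4) * ‖N‖ := by ring
          _ ≤ C := hC k t
    calc |(k : ℝ)| ^ m * ‖-(k : ℂ) ^ 4 * c k t - (k : ℂ) ^ 2 * N‖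
        ≤ |(k : ℝ)| ^ m * (|(k : ℝ)| ^ 4 * ‖c k t‖ + |(k : ℝ)| ^ 2 * ‖N‖) := by gcongr
      _ = |(k : ℝ)| ^ (m + 4) * ‖c k t‖ + |(k : ℝ)| ^ (m + 2) * ‖N‖ := by ring
      _ ≤ _ := add_le_add (hb k t) h2
  · have h1 := (hc.summable_norm (m + 4) t x).of_norm.hasSum
    have h2 := hc.hasSum_nonlinearity (m + 2) t x
    refine hasSum_of_eq (h1.neg.sub h2) fun k => ?_
    have e4 : (Complex.I * k : ℂ) ^ (m + 4) = (Complex.I * k) ^ m * (k : ℂ) ^ 4 := by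
      rw [pow_add, mul_pow _ _ 4, Complex.I_pow_four, one_mul]
    have e2 : (Complex.I * k : ℂ) ^ (m + 2) = -((Complex.I * k) ^ m * (k : ℂ) ^ 2) := by
      rw [pow_add, mul_pow _ _ 2, Complex.I_sq]; ring
    rw [e4, e2]
    ring

theorem hasFDerivAt (hc : IsFourierSolution c) (m : ℕ) {t : ℝ} (ht : 0 < t) (x : ℝ) :
    HasFDerivAt (fun p : ℝ × ℝ => fourierSeries c m p.1 p.2)
      ((ContinuousLinearMap.fst ℝ ℝ ℝ).smulRight (-fourierSeries c (m + 4) t x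
        - ∑ i ∈ Finset.range (m + 3), ((m + 2).choose i : ℂ)
        * (fourierSeries c (1 + i) t x * fourierSeries c (1 + (m + 2 - i)) t x))
      + (ContinuousLinearMap.snd ℝ ℝ ℝ).smulRight (fourierSeries c (m + 1) t x)) (t, x) := by
  obtain ⟨d, hd, ⟨u, hu, hub⟩, hsum⟩ := hc.exists_derivative m
  obtain ⟨v, hv, hvb⟩ := hc.summable_bound (m + 1)
  have key := hasFDerivAt_tsum_of_isPreconnected (𝕜 := ℝ) (hu.add hv)
    (s := Ioi (0 : ℝ) ×ˢ (univ : Set ℝ)) (x₀ := (t, x)) (x := (t, x))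
    (f := fun (k : ℤ) (p : ℝ × ℝ) => (Complex.I * k) ^ m * c k p.1 * character k p.2)
    (f' := fun (k : ℤ) (p : ℝ × ℝ) =>
      (ContinuousLinearMap.fst ℝ ℝ ℝ).smulRight ((Complex.I * k) ^ m * d k p.1 * character k p.2)
      + (ContinuousLinearMap.snd ℝ ℝ ℝ).smulRight
        ((Complex.I * k) ^ (m + 1) * c k p.1 * character k p.2))
    (isOpen_Ioi.prod isOpen_univ) ((convex_Ioi 0).prod convex_univ).isPreconnected
    ?_ ?_ ⟨ht, mem_univ _⟩ (hc.summable_norm m t x).of_norm ⟨ht, mem_univ _⟩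
  · refine key.congr_fderiv ?_
    have h1 := (ContinuousLinearMap.smulRightL ℝ (ℝ × ℝ) ℂ
      (ContinuousLinearMap.fst ℝ ℝ ℝ)).hasSum (hsum t x)
    have h2 := (ContinuousLinearMap.smulRightL ℝ (ℝ × ℝ) ℂ
      (ContinuousLinearMap.snd ℝ ℝ ℝ)).hasSum (hc.summable_norm (m + 1) t x).of_norm.hasSum
    exact (h1.add h2).tsum_eq
  · rintro k ⟨s, y⟩ ⟨hs, -⟩
    have h1 : HasFDerivAt (fun p : ℝ × ℝ => c k p.1) _ (s, y) :=
      HasFDerivAt.comp (g := c k) (s, y) (hd k s hs).hasFDerivAt hasFDerivAt_fst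
    have h2 : HasFDerivAt (fun p : ℝ × ℝ => character k p.2) _ (s, y) :=
      HasFDerivAt.comp (g := character k) (s, y) (hasDerivAt_character k y).hasFDerivAt
        hasFDerivAt_snd
    refine ((h1.const_mul ((Complex.I * k : ℂ) ^ m)).mul h2).congr_fderiv ?_
    ext
    · simp; ring
    · simp; ring
  · rintro k ⟨s, y⟩ -
    refine (norm_add_le _ _).trans (add_le_add ?_ ?_)
    · rw [ContinuousLinearMap.norm_smulRight_apply]
      refine (mul_le_of_le_one_left (norm_nonneg _) (ContinuousLinearMap.norm_fst_le ..)).trans ?_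
      rw [norm_mul, norm_mul, norm_I_mul_pow, norm_character, mul_one]
      exact hub k s
    · rw [ContinuousLinearMap.norm_smulRight_apply]
      refine (mul_le_of_le_one_left (norm_nonneg _) (ContinuousLinearMap.norm_snd_le ..)).trans ?_
      rw [norm_mul, norm_mul, norm_I_mul_pow, norm_character, mul_one]
      exact hvb k s

end IsFourierSolution

/-! ### Regular solutions from Fourier coefficients -/

/-- The real part of `fourierSeries`, equal to it if the coefficients are
conjugate-symmetric. -/
def realFourierSeries (c : ℤ → ℝ → ℂ) (m : ℕ) (t x : ℝ) : ℝ := (fourierSeries c m t x).re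

namespace IsFourierSolution

variable {c : ℤ → ℝ → ℂ}

theorem ofReal_realFourierSeries (hc : IsFourierSolution c) (m : ℕ) (t x : ℝ) :
    (realFourierSeries c m t x : ℂ) = fourierSeries c m t x := by
  refine Complex.conj_eq_iff_re.1 ?_
  rw [fourierSeries, Complex.conj_tsum, ← (Equiv.neg ℤ).tsum_eq]
  refine tsum_congr fun k => ?_
  simp only [Equiv.neg_apply, map_mul, map_pow, Complex.conj_I, map_intCast, hc.conj,
    conj_character, neg_neg]
  push_cast
  rw [neg_mul_neg]

theorem hasDerivAt_realFourierSeries (hc : IsFourierSolution c) (m : ℕ) (t x : ℝ) :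
    HasDerivAt (realFourierSeries c m t) (realFourierSeries c (m + 1) t x) x :=
  Complex.reCLM.hasFDerivAt.comp_hasDerivAt x (hc.hasDerivAt_space m t x)

/-- The time derivative of the `m`-th spatial derivative. -/
def timeDerivative (c : ℤ → ℝ → ℂ) (m : ℕ) (t x : ℝ) : ℝ :=
  -realFourierSeries c (m + 4) t x - ∑ i ∈ Finset.range (m + 3), ((m + 2).choose i : ℝ)
    * (realFourierSeries c (1 + i) t x * realFourierSeries c (1 + (m + 2 - i)) t x)

theorem hasFDerivAt_realFourierSeries (hc : IsFourierSolution c) (m : ℕ) {t : ℝ} (ht : 0 < t)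
    (x : ℝ) :
    HasFDerivAt (fun p : ℝ × ℝ => realFourierSeries c m p.1 p.2)
      ((ContinuousLinearMap.fst ℝ ℝ ℝ).smulRight (timeDerivative c m t x)
        + (ContinuousLinearMap.snd ℝ ℝ ℝ).smulRight (realFourierSeries c (m + 1) t x)) (t, x) := by
  refine HasFDerivAt.congr_fderiv
    (Complex.reCLM.hasFDerivAt.comp (t, x) (hc.hasFDerivAt m ht x)) ?_
  have h : -fourierSeries c (m + 4) t x
        - ∑ i ∈ Finset.range (m + 3), ((m + 2).choose i : ℂ)
        * (fourierSeries c (1 + i) t x * fourierSeries c (1 + (m + 2 - i)) t x)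
      = (timeDerivative c m t x : ℂ) := by
    simp only [← hc.ofReal_realFourierSeries, timeDerivative]
    push_cast
    ring
  rw [h, ← hc.ofReal_realFourierSeries]
  ext <;> simp

/-- Both partial derivatives of a series are polynomials in series of the same family. Hence
smoothness follows by induction on `n` for all `m` simultaneously. -/
theorem contDiffOn_realFourierSeries (hc : IsFourierSolution c) (n m : ℕ) :
    ContDiffOn ℝ n (fun p : ℝ × ℝ => realFourierSeries c m p.1 p.2)
      (Ioi (0 : ℝ) ×ˢ (univ : Set ℝ)) := by
  have hopen : IsOpen (Ioi (0 : ℝ) ×ˢ (univ : Set ℝ)) := isOpen_Ioi.prod isOpen_univ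
  have hd : ∀ m, ∀ p ∈ Ioi (0 : ℝ) ×ˢ (univ : Set ℝ), HasFDerivAt
      (fun p : ℝ × ℝ => realFourierSeries c m p.1 p.2) _ p :=
    fun m p hp => hc.hasFDerivAt_realFourierSeries m hp.1 p.2
  induction n generalizing m with
  | zero =>
    exact contDiffOn_zero.2 fun p hp => (hd m p hp).continuousAt.continuousWithinAt
  | succ n ih =>
    rw [Nat.cast_succ, contDiffOn_succ_iff_fderiv_of_isOpen hopen]
    refine ⟨fun p hp => (hd m p hp).differentiableAt.differentiableWithinAt, by simp, ?_⟩
    refine ContDiffOn.congr ?_ fun p hp => (hd m p hp).fderiv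
    have ht : ContDiffOn ℝ n (fun p : ℝ × ℝ => timeDerivative c m p.1 p.2)
        (Ioi (0 : ℝ) ×ˢ (univ : Set ℝ)) :=
      (ih (m + 4)).neg.sub (ContDiffOn.sum fun i _ =>
        contDiffOn_const.mul ((ih (1 + i)).mul (ih (1 + (m + 2 - i)))))
    exact (contDiffOn_const.smulRight ht).add (contDiffOn_const.smulRight (ih (m + 1)))

theorem periodic_realFourierSeries (m : ℕ) (t : ℝ) :
    Function.Periodic (realFourierSeries c m t) (2 * Real.pi) := fun x => by
  simp only [realFourierSeries, fourierSeries, character_periodic _ x]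

theorem continuous_realFourierSeries (hc : IsFourierSolution c) (m : ℕ) (t : ℝ) :
    Continuous (realFourierSeries c m t) :=
  continuous_iff_continuousAt.2 fun x => (hc.hasDerivAt_realFourierSeries m t x).continuousAt

/-- Dividing the coefficients by `ik` gives a periodic primitive. The undefined zero mode is
harmless because `c 0` vanishes. -/
theorem integral_realFourierSeries_zero (hc : IsFourierSolution c) (t : ℝ) :
    ∫ x in (0 : ℝ)..(2 * Real.pi), realFourierSeries c 0 t x = 0 := by
  obtain ⟨u, hu, hb⟩ := hc.summable_bound 0
  simp only [pow_zero, one_mul] at hb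
  have hb' : ∀ k x, ‖c k t * character k x‖ ≤ u k := fun k x => by
    rw [norm_mul, norm_character, mul_one]
    exact hb k t
  have hint : ∀ (k : ℤ), ‖c k t / (Complex.I * k)‖ ≤ u k := fun k => by
    rcases eq_or_ne k 0 with rfl | hk
    · simpa [hc.mean_zero] using (norm_nonneg _).trans (hb 0 t)
    · have : (1 : ℝ) ≤ |(k : ℝ)| := by exact_mod_cast Int.one_le_abs hk
      rw [norm_div, norm_mul, Complex.norm_I, one_mul, Complex.norm_intCast]
      exact (div_le_self (norm_nonneg _) this).trans (hb k t)
  have hW : ∀ x, HasDerivAt (fun x => ∑' k : ℤ, c k t / (Complex.I * k) * character k x)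
      (fourierSeries c 0 t x) x := by
    intro x
    simp only [fourierSeries, pow_zero, one_mul]
    refine hasDerivAt_tsum (g := fun (k : ℤ) x => c k t / (Complex.I * k) * character k x)
      (g' := fun (k : ℤ) x => c k t * character k x) hu ?_ hb' (y₀ := 0) ?_ x
    · intro k y
      refine ((hasDerivAt_character k y).const_mul _).congr_deriv ?_
      rcases eq_or_ne k 0 with rfl | hk
      · simp [hc.mean_zero]
      · have : (k : ℂ) ≠ 0 := by exact_mod_cast hk
        field_simp
    · refine Summable.of_norm_bounded hu fun k => ?_
      rw [norm_mul, norm_character, mul_one]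
      exact hint k
  exact integral_deriv_of_periodic
    (f := fun x => (∑' k : ℤ, c k t / (Complex.I * k) * character k x).re)
    (fun x => Complex.reCLM.hasFDerivAt.comp_hasDerivAt x (hW x))
    (hc.continuous_realFourierSeries 0 t)
    (fun x => by simp only [character_periodic _ x])

theorem memH1 (hc : IsFourierSolution c) (t : ℝ) : MemH1 (realFourierSeries c 0 t) where
  continuous := hc.continuous_realFourierSeries 0 t
  periodic := periodic_realFourierSeries 0 t
  mean_zero := hc.integral_realFourierSeries_zero t
  h1Norm_lt_top := (h1Norm_le_of_hasDerivAt (hc.hasDerivAt_realFourierSeries 0 t)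
    (hc.continuous_realFourierSeries 1 t) (periodic_realFourierSeries 0 t)).trans_lt
    ENNReal.ofReal_lt_top

/-- The sum of `|k| ‖c k s - c k t‖` dominates the difference of the `x`-derivatives uniformly in
`x`, and tends to zero by dominated convergence. -/
theorem tendsto_h1Norm (hc : IsFourierSolution c) (t : ℝ) :
    Tendsto (fun s => h1Norm (realFourierSeries c 0 s - realFourierSeries c 0 t)) (𝓝 t) (𝓝 0) := by
  obtain ⟨u, hu, hb⟩ := hc.summable_bound 1
  simp only [pow_one] at hb
  set B : ℝ → ℝ := fun s => ∑' k : ℤ, |(k : ℝ)| * ‖c k s - c k t‖ with hB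
  have hbd : ∀ s, ∀ k : ℤ, |(k : ℝ)| * ‖c k s - c k t‖ ≤ u k + u k := fun s k => by
    calc |(k : ℝ)| * ‖c k s - c k t‖ ≤ |(k : ℝ)| * (‖c k s‖ + ‖c k t‖) := by
          gcongr; exact norm_sub_le _ _
      _ ≤ u k + u k := by rw [mul_add]; exact add_le_add (hb k s) (hb k t)
  have hsum : ∀ s, Summable fun k : ℤ => |(k : ℝ)| * ‖c k s - c k t‖ := fun s =>
    Summable.of_nonneg_of_le (fun k => by positivity) (hbd s) (hu.add hu)
  have hBlim : Tendsto B (𝓝 t) (𝓝 0) := by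
    have h := tendsto_tsum_of_dominated_convergence (𝓕 := 𝓝 t)
      (f := fun s (k : ℤ) => |(k : ℝ)| * ‖c k s - c k t‖)
      (g := fun k => |(k : ℝ)| * ‖c k t - c k t‖) (hu.add hu)
      (fun k => (((hc.continuous k).sub continuous_const).norm.const_mul _).tendsto t)
      (Eventually.of_forall fun s k => by
        rw [Real.norm_of_nonneg (by positivity)]
        exact hbd s k)
    simpa using h
  have hpt : ∀ s x, |realFourierSeries c 1 s x - realFourierSeries c 1 t x| ≤ B s := by
    intro s x
    rw [realFourierSeries, realFourierSeries, ← Complex.sub_re]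
    refine (Complex.abs_re_le_norm _).trans ?_
    rw [fourierSeries, fourierSeries, ← (hc.summable_norm 1 s x).of_norm.tsum_sub
      (hc.summable_norm 1 t x).of_norm]
    have he : ∀ k : ℤ, ‖(Complex.I * k) ^ 1 * c k s * character k x
        - (Complex.I * k) ^ 1 * c k t * character k x‖ = |(k : ℝ)| * ‖c k s - c k t‖ := fun k => by
      rw [← sub_mul, ← mul_sub, norm_mul, norm_mul, norm_I_mul_pow, norm_character, pow_one,
        mul_one]
    refine (norm_tsum_le_tsum_norm ((hsum s).congr fun k => (he k).symm)).trans_eq ?_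
    exact tsum_congr he
  have hlim : Tendsto (fun s => ENNReal.ofReal (Real.sqrt (2 * Real.pi * B s ^ 2))) (𝓝 t)
      (𝓝 0) := by
    have h1 := (hBlim.pow 2).const_mul (2 * Real.pi)
    have h2 := (ENNReal.continuous_ofReal.tendsto _).comp
      ((Real.continuous_sqrt.tendsto _).comp h1)
    simpa [Function.comp_def] using h2
  refine tendsto_of_tendsto_of_tendsto_of_le_of_le tendsto_const_nhds hlim (fun s => zero_le)
    fun s => ?_
  refine (h1Norm_le_of_hasDerivAt
    (g := fun x => realFourierSeries c 1 s x - realFourierSeries c 1 t x)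
    (fun x => (hc.hasDerivAt_realFourierSeries 0 s x).sub (hc.hasDerivAt_realFourierSeries 0 t x))
    ((hc.continuous_realFourierSeries 1 s).sub (hc.continuous_realFourierSeries 1 t)) ?_).trans ?_
  · intro x
    simp only [Pi.sub_apply, periodic_realFourierSeries _ _ x]
  · refine ENNReal.ofReal_le_ofReal (Real.sqrt_le_sqrt ?_)
    have c1 := hc.continuous_realFourierSeries 1 s
    have c2 := hc.continuous_realFourierSeries 1 t
    have := intervalIntegral.integral_mono_on (a := 0) (b := 2 * Real.pi)
      (f := fun x => (realFourierSeries c 1 s x - realFourierSeries c 1 t x) ^ 2)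
      (g := fun _ => B s ^ 2) Real.two_pi_pos.le
      (Continuous.intervalIntegrable (by fun_prop) _ _) (intervalIntegrable_const (μ := volume))
      fun x _ => sq_le_sq' (neg_le_of_abs_le (hpt s x)) (le_of_abs_le (hpt s x))
    simpa using this

/-- A solution in Fourier variables defines a global regular solution. -/
theorem isRegularSolution (hc : IsFourierSolution c) :
    IsRegularSolution (realFourierSeries c 0 0) ⊤ (realFourierSeries c 0) where
  initial := rfl
  memH1 := fun t _ _ => hc.memH1 t
  continuous_h1 := fun t _ _ => (hc.tendsto_h1Norm t).mono_left nhdsWithin_le_nhds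
  smooth := by
    have : {t : ℝ | 0 < t ∧ (t : EReal) < ⊤} = Ioi 0 := by
      ext t
      simp [EReal.coe_lt_top]
    rw [this, contDiffOn_infty]
    exact fun n => hc.contDiffOn_realFourierSeries n 0
  equation := fun t ht _ x => by
    have hd : ∀ m, deriv (realFourierSeries c m t) = realFourierSeries c (m + 1) t :=
      fun m => funext fun x => (hc.hasDerivAt_realFourierSeries m t x).deriv
    have h1 : HasDerivAt (fun s => realFourierSeries c 0 s x) (timeDerivative c 0 t x) t := by
      have := (hc.hasFDerivAt_realFourierSeries 0 ht x).comp_hasDerivAt t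
        ((hasDerivAt_id t).prodMk (hasDerivAt_const t x))
      simpa [Function.comp_def] using this
    have h2 : deriv (fun y => realFourierSeries c 1 t y ^ 2)
        = fun y => 2 * (realFourierSeries c 1 t y * realFourierSeries c 2 t y) :=
      funext fun y => ((hc.hasDerivAt_realFourierSeries 1 t y).pow 2).deriv.trans
        (by norm_num; ring)
    have h3 : deriv (fun y => 2 * (realFourierSeries c 1 t y * realFourierSeries c 2 t y)) x
        = 2 * (realFourierSeries c 2 t x * realFourierSeries c 2 t x
          + realFourierSeries c 1 t x * realFourierSeries c 3 t x) :=
      (((hc.hasDerivAt_realFourierSeries 1 t x).mul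
        (hc.hasDerivAt_realFourierSeries 2 t x)).const_mul 2).deriv
    rw [h1.deriv]
    simp only [iteratedDeriv_succ, iteratedDeriv_zero, hd, zero_add, Nat.reduceAdd, h2, h3]
    simp only [timeDerivative, Finset.sum_range_succ, Finset.sum_range_zero]
    norm_num [Nat.choose]
    ring

end IsFourierSolution

/-! ### Majorants for the Picard iteration -/

theorem sq_tsum_mul_le {ι : Type*} (f g : ι → ℝ≥0∞) :
    (∑' i, f i * g i) ^ 2 ≤ (∑' i, f i ^ 2) * ∑' i, g i ^ 2 := by
  have h : ∑' i, f i * g i ≤ (∑' i, f i ^ 2) ^ (1 / 2 : ℝ) * (∑' i, g i ^ 2) ^ (1 / 2 : ℝ) := by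
    rw [ENNReal.tsum_eq_iSup_sum]
    refine iSup_le fun s => (ENNReal.inner_le_Lp_mul_Lq s f g Real.HolderConjugate.two_two).trans ?_
    simp only [ENNReal.rpow_two]
    gcongr
    · exact ENNReal.sum_le_tsum s
    · exact ENNReal.sum_le_tsum s
  calc (∑' i, f i * g i) ^ 2
      ≤ ((∑' i, f i ^ 2) ^ (1 / 2 : ℝ) * (∑' i, g i ^ 2) ^ (1 / 2 : ℝ)) ^ 2 := by gcongr
    _ = _ := by
      rw [mul_pow, ← ENNReal.rpow_two, ← ENNReal.rpow_two, ← ENNReal.rpow_mul, ← ENNReal.rpow_mul]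
      norm_num

theorem add_sq_le_two_mul (x y : ℝ≥0∞) : (x + y) ^ 2 ≤ 2 * x ^ 2 + 2 * y ^ 2 := by
  have h := ENNReal.rpow_add_le_mul_rpow_add_rpow x y (p := 2) (by norm_num)
  norm_num at h
  rwa [mul_add] at h

theorem le_of_sq_le_sq {x y : ℝ≥0∞} (h : x ^ 2 ≤ y ^ 2) : x ≤ y := by
  rw [← ENNReal.rpow_two, ← ENNReal.rpow_two] at h
  exact (ENNReal.rpow_le_rpow_iff two_pos).1 h

/-- The quadratic term with all summands replaced by absolute values. -/
def majorantConv (b : ℤ → ℝ≥0∞) (k : ℤ) : ℝ≥0∞ :=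
  ∑' j : ℤ, (‖(j : ℂ)⁻¹‖ₑ * b j) * (‖((k - j : ℤ) : ℂ)⁻¹‖ₑ * b (k - j))

/-- The sum `∑ j⁻⁴` over the nonzero integers. -/
def quarticSum : ℝ≥0∞ := ∑' j : ℤ, ‖(j : ℂ)⁻¹‖ₑ ^ 4

/-- Cauchy-Schwarz in `j` separates the weights from `b j * b (k - j)`. After exchanging sums, the
latter contributes exactly `(∑ b²)²`. The zero modes drop out, since `0⁻¹ = 0`. -/
theorem tsum_majorantConv_sq_le (b : ℤ → ℝ≥0∞) :
    ∑' k, majorantConv b k ^ 2 ≤ quarticSum * (∑' k, b k ^ 2) ^ 2 := by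
  -- A second Cauchy-Schwarz, with reflection `j ↦ k - j`, makes the bound independent of `k`.
  have hw : ∀ k : ℤ, ∑' j : ℤ, (‖(j : ℂ)⁻¹‖ₑ * ‖((k - j : ℤ) : ℂ)⁻¹‖ₑ) ^ 2 ≤ quarticSum := by
    intro k
    refine le_of_sq_le_sq ?_
    simp only [mul_pow]
    refine (sq_tsum_mul_le _ _).trans_eq ?_
    simp only [← pow_mul]
    have h := (Equiv.subLeft k).tsum_eq (fun l : ℤ => ‖(l : ℂ)⁻¹‖ₑ ^ (2 * 2))
    simp only [Equiv.subLeft_apply] at h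
    rw [h, sq]
    rfl
  have hk : ∀ k, majorantConv b k ^ 2 ≤ quarticSum * ∑' j, (b j * b (k - j)) ^ 2 := by
    intro k
    have : majorantConv b k
        = ∑' j : ℤ, (‖(j : ℂ)⁻¹‖ₑ * ‖((k - j : ℤ) : ℂ)⁻¹‖ₑ) * (b j * b (k - j)) :=
      tsum_congr fun j => by ring
    rw [this]
    exact (sq_tsum_mul_le _ _).trans (mul_le_mul_left (hw k) _)
  refine (ENNReal.tsum_le_tsum hk).trans_eq ?_
  rw [ENNReal.tsum_mul_left, ENNReal.tsum_comm]
  congr 1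
  simp only [mul_pow, ENNReal.tsum_mul_left]
  have : ∀ j : ℤ, ∑' k, b (k - j) ^ 2 = ∑' k, b k ^ 2 := fun j =>
    (Equiv.subRight j).tsum_eq fun k => b k ^ 2
  simp only [this, ENNReal.tsum_mul_right]
  rw [sq]

/-- The iterates majorizing the Picard iterates. -/
def majorant (α : ℤ → ℂ) : ℕ → ℤ → ℝ≥0∞
  | 0 => 0
  | n + 1 => fun k => ‖α k‖ₑ + majorantConv (majorant α n) k

/-- The hypothesis says that the squared `ℓ²` ball of size `Y` is invariant under the majorant
iteration, by `(x + y)^2 ≤ 2 x^2 + 2 y^2`. -/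
theorem tsum_majorant_sq_le {α : ℤ → ℂ} {Y : ℝ≥0∞}
    (hY : 2 * (∑' k, ‖α k‖ₑ ^ 2) + 2 * (quarticSum * Y ^ 2) ≤ Y) (n : ℕ) :
    ∑' k, majorant α n k ^ 2 ≤ Y := by
  induction n with
  | zero => simp [majorant]
  | succ n ih =>
    calc ∑' k, majorant α (n + 1) k ^ 2
        ≤ ∑' k, (2 * ‖α k‖ₑ ^ 2 + 2 * majorantConv (majorant α n) k ^ 2) :=
          ENNReal.tsum_le_tsum fun k => add_sq_le_two_mul _ _
      _ = 2 * (∑' k, ‖α k‖ₑ ^ 2) + 2 * ∑' k, majorantConv (majorant α n) k ^ 2 := by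
          rw [ENNReal.tsum_add, ENNReal.tsum_mul_left, ENNReal.tsum_mul_left]
      _ ≤ 2 * (∑' k, ‖α k‖ₑ ^ 2) + 2 * (quarticSum * Y ^ 2) := by
          gcongr
          exact (tsum_majorantConv_sq_le _).trans (by gcongr)
      _ ≤ Y := hY

theorem majorantConv_mono {b b' : ℤ → ℝ≥0∞} (h : ∀ k, b k ≤ b' k) (k : ℤ) :
    majorantConv b k ≤ majorantConv b' k :=
  ENNReal.tsum_le_tsum fun j => by gcongr <;> exact h _

theorem majorant_le_succ (α : ℤ → ℂ) (n : ℕ) (k : ℤ) : majorant α n k ≤ majorant α (n + 1) k := by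
  induction n generalizing k with
  | zero => simp [majorant]
  | succ n ih => exact add_le_add le_rfl (majorantConv_mono ih k)

theorem monotone_majorant (α : ℤ → ℂ) (k : ℤ) : Monotone fun n => majorant α n k :=
  monotone_nat_of_le_succ fun n => majorant_le_succ α n k

/-- The limit of the majorants. -/
def majorantLimit (α : ℤ → ℂ) (k : ℤ) : ℝ≥0∞ := ⨆ n, majorant α n k

theorem majorant_le_limit (α : ℤ → ℂ) (n : ℕ) (k : ℤ) : majorant α n k ≤ majorantLimit α k :=
  le_iSup (fun n => majorant α n k) n

theorem tendsto_majorant (α : ℤ → ℂ) (k : ℤ) :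
    Tendsto (fun n => majorant α n k) atTop (𝓝 (majorantLimit α k)) :=
  tendsto_atTop_iSup (monotone_majorant α k)

theorem tsum_majorantLimit_sq_le {α : ℤ → ℂ} {Y : ℝ≥0∞}
    (hY : 2 * (∑' k, ‖α k‖ₑ ^ 2) + 2 * (quarticSum * Y ^ 2) ≤ Y) :
    ∑' k, majorantLimit α k ^ 2 ≤ Y := by
  rw [ENNReal.tsum_eq_iSup_sum]
  refine iSup_le fun s => ?_
  have h : Tendsto (fun n => ∑ k ∈ s, majorant α n k ^ 2) atTop
      (𝓝 (∑ k ∈ s, majorantLimit α k ^ 2)) :=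
    tendsto_finsetSum _ fun k _ =>
      (ENNReal.continuous_pow 2).continuousAt.tendsto.comp (tendsto_majorant α k)
  exact le_of_tendsto' h fun n => (ENNReal.sum_le_tsum s).trans (tsum_majorant_sq_le hY n)

theorem majorantConv_ne_top {b : ℤ → ℝ≥0∞} (hS : quarticSum ≠ ⊤) (hb : ∑' k, b k ^ 2 ≠ ⊤)
    (k : ℤ) : majorantConv b k ≠ ⊤ := by
  have h := (ENNReal.le_tsum (f := fun k => majorantConv b k ^ 2) k).trans
    (tsum_majorantConv_sq_le b)
  intro htop
  simp only [htop] at h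
  have h2 : quarticSum * (∑' k, b k ^ 2) ^ 2 ≠ ⊤ :=
    ENNReal.mul_ne_top hS (ENNReal.pow_ne_top hb)
  exact h2 (top_le_iff.1 (le_trans (by simp) h))

/-- Passing to the limit in finite partial sums over `j` shows the limit to be a supersolution,
which is all the Picard argument needs. Finiteness makes multiplication in `ℝ≥0∞` continuous at the
limits. -/
theorem le_majorantLimit (α : ℤ → ℂ) (hfin : ∀ k, majorantLimit α k ≠ ⊤) (k : ℤ) :
    ‖α k‖ₑ + majorantConv (majorantLimit α) k ≤ majorantLimit α k := by
  rw [majorantConv, ENNReal.tsum_eq_iSup_sum, ENNReal.add_iSup]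
  refine iSup_le fun s => ?_
  have h : Tendsto (fun n => ‖α k‖ₑ + ∑ j ∈ s, (‖(j : ℂ)⁻¹‖ₑ * majorant α n j)
      * (‖((k - j : ℤ) : ℂ)⁻¹‖ₑ * majorant α n (k - j))) atTop
      (𝓝 (‖α k‖ₑ + ∑ j ∈ s, (‖(j : ℂ)⁻¹‖ₑ * majorantLimit α j)
      * (‖((k - j : ℤ) : ℂ)⁻¹‖ₑ * majorantLimit α (k - j)))) := by
    refine tendsto_const_nhds.add (tendsto_finsetSum _ fun j _ => ?_)
    have hm : ∀ j : ℤ, Tendsto (fun n => ‖(j : ℂ)⁻¹‖ₑ * majorant α n j) atTop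
        (𝓝 (‖(j : ℂ)⁻¹‖ₑ * majorantLimit α j)) := fun j =>
      ENNReal.Tendsto.const_mul (tendsto_majorant α j) (Or.inr enorm_ne_top)
    have hf : ∀ j : ℤ, ‖(j : ℂ)⁻¹‖ₑ * majorantLimit α j ≠ ⊤ := fun j =>
      ENNReal.mul_ne_top enorm_ne_top (hfin j)
    exact ENNReal.Tendsto.mul (hm j) (Or.inr (hf _)) (hm (k - j)) (Or.inr (hf _))
  refine le_of_tendsto' h fun n => le_trans ?_ (majorant_le_limit α (n + 1) k)
  exact add_le_add le_rfl (ENNReal.sum_le_tsum s)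

/-! ### The Duhamel operator -/

/-- The solution of `y' = -k⁴ y - k⁴ g`, `y 0 = a`, extended by a constant to negative times. -/
def duhamel (k : ℤ) (a : ℂ) (g : ℝ → ℂ) (t : ℝ) : ℂ :=
  (Real.exp (-((k : ℝ) ^ 4 * max t 0)) : ℝ)
    * (a - ((k : ℝ) ^ 4 : ℝ) * ∫ s in (0 : ℝ)..max t 0, (Real.exp ((k : ℝ) ^ 4 * s) : ℝ) * g s)

theorem continuous_exp_mul {g : ℝ → ℂ} (hg : Continuous g) (κ : ℝ) :
    Continuous fun s => ((Real.exp (κ * s) : ℝ) : ℂ) * g s := by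
  fun_prop

theorem continuous_duhamel (k : ℤ) (a : ℂ) {g : ℝ → ℂ} (hg : Continuous g) :
    Continuous (duhamel k a g) := by
  have h1 : Continuous fun t : ℝ => max t 0 := continuous_id.max continuous_const
  have h2 : Continuous fun x : ℝ =>
      ∫ s in (0 : ℝ)..x, ((Real.exp ((k : ℝ) ^ 4 * s) : ℝ) : ℂ) * g s :=
    intervalIntegral.continuous_primitive
      (fun a b => (continuous_exp_mul hg _).intervalIntegrable a b) 0
  unfold duhamel
  exact (Complex.continuous_ofReal.comp (Real.continuous_exp.comp
    (continuous_const.mul h1).neg)).mul (continuous_const.sub (continuous_const.mul (h2.comp h1)))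

/-- The kernel `κ exp(-κ (τ - s))` with `κ = k⁴` has mass `1 - exp(-κ τ) ≤ 1` on `[0, τ]`. Thus the
four derivatives in front of the nonlinearity are recovered exactly, uniformly in `k` and time. -/
theorem norm_duhamel_sub_le (k : ℤ) (a : ℂ) {g h : ℝ → ℂ} (hg : Continuous g) (hh : Continuous h)
    {C : ℝ} (hC : ∀ s, ‖g s - h s‖ ≤ C) (t : ℝ) :
    ‖duhamel k a g t - duhamel k a h t‖ ≤ C := by
  set κ : ℝ := (k : ℝ) ^ 4 with hκ
  have hκ0 : 0 ≤ κ := by positivity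
  set τ := max t 0 with hτ
  have hτ0 : 0 ≤ τ := le_max_right _ _
  have hC0 : 0 ≤ C := (norm_nonneg _).trans (hC 0)
  have e : duhamel k a g t - duhamel k a h t = -((Real.exp (-(κ * τ)) : ℝ) * ((κ : ℂ)
      * ∫ s in (0 : ℝ)..τ, ((Real.exp (κ * s) : ℝ) : ℂ) * (g s - h s))) := by
    simp only [mul_sub]
    rw [intervalIntegral.integral_sub ((continuous_exp_mul hg _).intervalIntegrable _ _)
      ((continuous_exp_mul hh _).intervalIntegrable _ _)]
    simp only [duhamel]
    ring
  have hint : ∫ s in (0 : ℝ)..τ, κ * Real.exp (κ * s) = Real.exp (κ * τ) - 1 := by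
    rw [intervalIntegral.integral_eq_sub_of_hasDerivAt (f := fun s => Real.exp (κ * s))
      (fun s _ => (((hasDerivAt_id s).const_mul κ).exp).congr_deriv (by simp; ring))
      (Continuous.intervalIntegrable (by fun_prop) _ _)]
    simp
  have hn : ‖∫ s in (0 : ℝ)..τ, ((Real.exp (κ * s) : ℝ) : ℂ) * (g s - h s)‖
      ≤ ∫ s in (0 : ℝ)..τ, Real.exp (κ * s) * C := by
    refine intervalIntegral.norm_integral_le_of_norm_le hτ0 (Eventually.of_forall fun s _ => ?_)
      (Continuous.intervalIntegrable (by fun_prop) _ _)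
    rw [norm_mul, Complex.norm_of_nonneg (Real.exp_pos _).le]
    gcongr
    exact hC s
  rw [e, norm_neg, norm_mul, norm_mul, Complex.norm_of_nonneg (Real.exp_pos _).le,
    Complex.norm_of_nonneg hκ0]
  calc Real.exp (-(κ * τ)) * (κ * ‖∫ s in (0 : ℝ)..τ, ((Real.exp (κ * s) : ℝ) : ℂ) * (g s - h s)‖)
      ≤ Real.exp (-(κ * τ)) * (κ * ∫ s in (0 : ℝ)..τ, Real.exp (κ * s) * C) := by gcongr
    _ = Real.exp (-(κ * τ)) * ((Real.exp (κ * τ) - 1) * C) := by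
        rw [← hint, intervalIntegral.integral_mul_const, intervalIntegral.integral_const_mul,
          mul_assoc]
    _ = (1 - Real.exp (-(κ * τ))) * C := by
        rw [← mul_assoc, mul_sub, ← Real.exp_add]; simp
    _ ≤ 1 * C := by
        gcongr
        linarith [Real.exp_pos (-(κ * τ))]
    _ = C := one_mul C

theorem norm_duhamel_zero_le (k : ℤ) (a : ℂ) (t : ℝ) : ‖duhamel k a 0 t‖ ≤ ‖a‖ := by
  have : duhamel k a 0 t = (Real.exp (-((k : ℝ) ^ 4 * max t 0)) : ℝ) * a := by simp [duhamel]
  rw [this, norm_mul, Complex.norm_of_nonneg (Real.exp_pos _).le]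
  refine mul_le_of_le_one_left (norm_nonneg _) (Real.exp_le_one_iff.2 ?_)
  exact neg_nonpos.2 (mul_nonneg (by positivity) (le_max_right _ _))

theorem norm_duhamel_le (k : ℤ) (a : ℂ) {g : ℝ → ℂ} (hg : Continuous g) {C : ℝ}
    (hC : ∀ s, ‖g s‖ ≤ C) (t : ℝ) : ‖duhamel k a g t‖ ≤ ‖a‖ + C := by
  have h1 := norm_duhamel_sub_le k a hg (h := 0) continuous_const (C := C)
    (fun s => by simpa using hC s) t
  have h2 := norm_duhamel_zero_le k a t
  calc ‖duhamel k a g t‖ = ‖duhamel k a 0 t + (duhamel k a g t - duhamel k a 0 t)‖ := by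
        rw [add_sub_cancel]
    _ ≤ _ := (norm_add_le _ _).trans (add_le_add h2 h1)

theorem enorm_duhamel_sub_le (k : ℤ) (a : ℂ) {g h : ℝ → ℂ} (hg : Continuous g)
    (hh : Continuous h) {C : ℝ≥0∞} (hC : ∀ s, ‖g s - h s‖ₑ ≤ C) (t : ℝ) :
    ‖duhamel k a g t - duhamel k a h t‖ₑ ≤ C := by
  by_cases htop : C = ⊤
  · exact htop ▸ le_top
  rw [← ofReal_norm, ENNReal.ofReal_le_iff_le_toReal htop]
  refine norm_duhamel_sub_le k a hg hh (fun s => ?_) t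
  rw [← ENNReal.ofReal_le_iff_le_toReal htop, ofReal_norm]
  exact hC s

theorem enorm_duhamel_zero_le (k : ℤ) (a : ℂ) (t : ℝ) : ‖duhamel k a 0 t‖ₑ ≤ ‖a‖ₑ := by
  rw [← ofReal_norm, ← ofReal_norm]
  exact ENNReal.ofReal_le_ofReal (norm_duhamel_zero_le k a t)

theorem hasDerivAt_duhamel (k : ℤ) (a : ℂ) {g : ℝ → ℂ} (hg : Continuous g) {t : ℝ} (ht : 0 < t) :
    HasDerivAt (duhamel k a g) (-(k : ℂ) ^ 4 * duhamel k a g t - (k : ℂ) ^ 4 * g t) t := by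
  set κ : ℝ := (k : ℝ) ^ 4 with hκ
  have h1 : HasDerivAt (fun s : ℝ => ((Real.exp (-(κ * s)) : ℝ) : ℂ))
      ((Real.exp (-(κ * t)) * (-(κ * 1)) : ℝ) : ℂ) t :=
    HasDerivAt.ofReal_comp (((hasDerivAt_id t).const_mul κ).neg.exp)
  have hc := continuous_exp_mul hg κ
  have h2 : HasDerivAt (fun x : ℝ => ∫ s in (0 : ℝ)..x, ((Real.exp (κ * s) : ℝ) : ℂ) * g s)
      (((Real.exp (κ * t) : ℝ) : ℂ) * g t) t :=
    intervalIntegral.integral_hasDerivAt_right (hc.intervalIntegrable _ _)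
      hc.aestronglyMeasurable.stronglyMeasurableAtFilter hc.continuousAt
  have h3 := h1.mul ((h2.const_mul (κ : ℂ)).const_sub a)
  have he : duhamel k a g =ᶠ[𝓝 t] fun s => ((Real.exp (-(κ * s)) : ℝ) : ℂ)
      * (a - κ * ∫ r in (0 : ℝ)..s, ((Real.exp (κ * r) : ℝ) : ℂ) * g r) := by
    filter_upwards [lt_mem_nhds ht] with s hs
    rw [duhamel, max_eq_left hs.le]
  refine (h3.congr_of_eventuallyEq he).congr_deriv ?_
  rw [he.eq_of_nhds]
  have hexp : ((Real.exp (-(κ * t)) : ℝ) : ℂ) * ((Real.exp (κ * t) : ℝ) : ℂ) = 1 := by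
    rw [← Complex.ofReal_mul, ← Real.exp_add]
    simp
  have hk : (k : ℂ) ^ 4 = (κ : ℂ) := by rw [hκ]; push_cast; rfl
  rw [hk, Complex.ofReal_mul]
  push_cast at hexp ⊢
  linear_combination (-(κ : ℂ) * g t) * hexp

theorem duhamel_zero (k : ℤ) (a : ℂ) (g : ℝ → ℂ) : duhamel k a g 0 = a := by simp [duhamel]

theorem conj_duhamel (k : ℤ) (a : ℂ) (g : ℝ → ℂ) (t : ℝ) :
    (starRingEnd ℂ) (duhamel k a g t)
      = duhamel (-k) ((starRingEnd ℂ) a) (fun s => (starRingEnd ℂ) (g s)) t := by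
  have h4 : (((-k : ℤ) : ℝ)) ^ 4 = (k : ℝ) ^ 4 := by push_cast; ring
  have hint : ∀ (f : ℝ → ℂ) (x y : ℝ), (starRingEnd ℂ) (∫ s in x..y, f s)
      = ∫ s in x..y, (starRingEnd ℂ) (f s) := fun f x y => by
    simp only [intervalIntegral, map_sub, integral_conj]
  rw [duhamel, duhamel, h4, map_mul, map_sub, map_mul, Complex.conj_ofReal, Complex.conj_ofReal,
    hint]
  simp only [map_mul, Complex.conj_ofReal]

/-! ### The Picard iteration -/

/-- The quadratic term in the variables `k² c_k`. -/
def weightedConv (γ : ℤ → ℝ → ℂ) (k : ℤ) (s : ℝ) : ℂ :=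
  ∑' j : ℤ, ((j : ℂ)⁻¹ * γ j s) * (((k - j : ℤ) : ℂ)⁻¹ * γ (k - j) s)

section Conv

variable {γ γ' : ℤ → ℝ → ℂ} {b b' : ℤ → ℝ≥0∞}

theorem enorm_conv_term_le (hb : ∀ k s, ‖γ k s‖ₑ ≤ b k) (k j : ℤ) (s : ℝ) :
    ‖((j : ℂ)⁻¹ * γ j s) * (((k - j : ℤ) : ℂ)⁻¹ * γ (k - j) s)‖ₑ
      ≤ (‖(j : ℂ)⁻¹‖ₑ * b j) * (‖((k - j : ℤ) : ℂ)⁻¹‖ₑ * b (k - j)) := by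
  rw [enorm_mul, enorm_mul, enorm_mul]
  gcongr <;> exact hb _ _

theorem summable_conv (hb : ∀ k s, ‖γ k s‖ₑ ≤ b k) {k : ℤ} (hk : majorantConv b k ≠ ⊤) (s : ℝ) :
    Summable fun j : ℤ => ((j : ℂ)⁻¹ * γ j s) * (((k - j : ℤ) : ℂ)⁻¹ * γ (k - j) s) := by
  refine Summable.of_norm (tsum_enorm_ne_top_iff_summable_norm.1 (ne_top_of_le_ne_top hk ?_))
  exact ENNReal.tsum_le_tsum fun j => enorm_conv_term_le hb k j s

theorem continuous_weightedConv (hγ : ∀ k, Continuous (γ k)) (hb : ∀ k s, ‖γ k s‖ₑ ≤ b k) {k : ℤ}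
    (hk : majorantConv b k ≠ ⊤) : Continuous (weightedConv γ k) := by
  refine continuous_tsum (fun j => ?_) (ENNReal.summable_toReal hk) fun j s => ?_
  · exact (continuous_const.mul (hγ j)).mul (continuous_const.mul (hγ (k - j)))
  · rw [← ENNReal.ofReal_le_iff_le_toReal (ENNReal.ne_top_of_tsum_ne_top hk j), ofReal_norm]
    exact enorm_conv_term_le hb k j s

/-- The increments of the quadratic term are controlled by those of its majorant. -/
theorem enorm_weightedConv_sub_add_le (hb : ∀ k s, ‖γ k s‖ₑ ≤ b k)
    (hb' : ∀ k s, ‖γ' k s‖ₑ ≤ b' k) (hd : ∀ k s, ‖γ' k s - γ k s‖ₑ + b k ≤ b' k) {k : ℤ}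
    (hk : majorantConv b k ≠ ⊤) (hk' : majorantConv b' k ≠ ⊤) (s : ℝ) :
    ‖weightedConv γ' k s - weightedConv γ k s‖ₑ + majorantConv b k ≤ majorantConv b' k := by
  rw [weightedConv, weightedConv, ← (summable_conv hb' hk' s).tsum_sub (summable_conv hb hk s)]
  refine (add_le_add enorm_tsum_le_tsum_enorm le_rfl).trans ?_
  rw [majorantConv, majorantConv, ← ENNReal.tsum_add]
  refine ENNReal.tsum_le_tsum fun j => ?_
  have e : ((j : ℂ)⁻¹ * γ' j s) * (((k - j : ℤ) : ℂ)⁻¹ * γ' (k - j) s)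
      - ((j : ℂ)⁻¹ * γ j s) * (((k - j : ℤ) : ℂ)⁻¹ * γ (k - j) s)
      = (j : ℂ)⁻¹ * ((k - j : ℤ) : ℂ)⁻¹ * ((γ' j s - γ j s) * γ' (k - j) s
        + γ j s * (γ' (k - j) s - γ (k - j) s)) := by ring
  rw [e, enorm_mul, enorm_mul]
  set x := ‖γ' j s - γ j s‖ₑ
  set y := ‖γ' (k - j) s - γ (k - j) s‖ₑ
  have h1 : ‖(γ' j s - γ j s) * γ' (k - j) s + γ j s * (γ' (k - j) s - γ (k - j) s)‖ₑ
      ≤ x * b' (k - j) + b j * y := by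
    refine (enorm_add_le _ _).trans ?_
    rw [enorm_mul, enorm_mul]
    gcongr
    · exact hb' _ _
    · exact hb _ _
  -- The product increment telescopes as in `b'b' - bb = (b' - b) b' + b (b' - b)`, kept additive to
  -- avoid truncated subtraction.
  have h2 : x * b' (k - j) + b j * y + b j * b (k - j) ≤ b' j * b' (k - j) :=
    calc x * b' (k - j) + b j * y + b j * b (k - j)
        = x * b' (k - j) + b j * (y + b (k - j)) := by ring
      _ ≤ x * b' (k - j) + b j * b' (k - j) := by gcongr; exact hd _ _
      _ = (x + b j) * b' (k - j) := by ring
      _ ≤ b' j * b' (k - j) := by gcongr; exact hd _ _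
  calc ‖(j : ℂ)⁻¹‖ₑ * ‖((k - j : ℤ) : ℂ)⁻¹‖ₑ
        * ‖(γ' j s - γ j s) * γ' (k - j) s + γ j s * (γ' (k - j) s - γ (k - j) s)‖ₑ
      + (‖(j : ℂ)⁻¹‖ₑ * b j) * (‖((k - j : ℤ) : ℂ)⁻¹‖ₑ * b (k - j))
      ≤ ‖(j : ℂ)⁻¹‖ₑ * ‖((k - j : ℤ) : ℂ)⁻¹‖ₑ * (x * b' (k - j) + b j * y)
      + (‖(j : ℂ)⁻¹‖ₑ * b j) * (‖((k - j : ℤ) : ℂ)⁻¹‖ₑ * b (k - j)) := by gcongr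
    _ = ‖(j : ℂ)⁻¹‖ₑ * ‖((k - j : ℤ) : ℂ)⁻¹‖ₑ
        * (x * b' (k - j) + b j * y + b j * b (k - j)) := by ring
    _ ≤ ‖(j : ℂ)⁻¹‖ₑ * ‖((k - j : ℤ) : ℂ)⁻¹‖ₑ * (b' j * b' (k - j)) := by gcongr
    _ = _ := by ring

theorem conj_weightedConv (h : ∀ k s, (starRingEnd ℂ) (γ k s) = γ (-k) s) (k : ℤ) (s : ℝ) :
    (starRingEnd ℂ) (weightedConv γ k s) = weightedConv γ (-k) s := by
  rw [weightedConv, weightedConv, Complex.conj_tsum, ← (Equiv.neg ℤ).tsum_eq]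
  refine tsum_congr fun j => ?_
  simp only [Equiv.neg_apply, map_mul, map_inv₀, map_intCast, h, neg_neg]
  rw [show -(k - -j) = -k - j by ring, show k - -j = -(-k - j) by ring]
  push_cast
  simp only [inv_neg]
  ring

end Conv

/-- The Picard iterates for the equation in the variables `k² c_k`. -/
def picard (α : ℤ → ℂ) : ℕ → ℤ → ℝ → ℂ
  | 0 => 0
  | n + 1 => fun k => duhamel k (α k) (weightedConv (picard α n) k)

section Picard

variable {α : ℤ → ℂ}

theorem conj_picard (hα : ∀ k, (starRingEnd ℂ) (α k) = α (-k)) (n : ℕ) (k : ℤ) (t : ℝ) :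
    (starRingEnd ℂ) (picard α n k t) = picard α n (-k) t := by
  induction n generalizing k t with
  | zero => simp [picard]
  | succ n ih =>
    simp only [picard]
    rw [conj_duhamel, hα]
    simp only [conj_weightedConv ih]

theorem majorantConv_limit_ne_top (hS : quarticSum ≠ ⊤) (hL : ∑' k, majorantLimit α k ^ 2 ≠ ⊤)
    (n : ℕ) (k : ℤ) : majorantConv (majorant α n) k ≠ ⊤ :=
  ne_top_of_le_ne_top (majorantConv_ne_top hS hL k)
    (majorantConv_mono (majorant_le_limit α n) k)

/-- Increments of the iterates are dominated by increments of the majorants, uniformly in time. The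
domination passes through the convolution by bilinearity and through `duhamel` by its unit Lipschitz
bound. -/
theorem picard_properties (hS : quarticSum ≠ ⊤) (hL : ∑' k, majorantLimit α k ^ 2 ≠ ⊤) (n : ℕ) :
    (∀ k, Continuous (picard α n k)) ∧ (∀ k t, ‖picard α n k t‖ₑ ≤ majorant α n k) ∧
      ∀ k t, ‖picard α (n + 1) k t - picard α n k t‖ₑ + majorant α n k ≤ majorant α (n + 1) k := by
  have hfin := majorantConv_limit_ne_top hS hL
  induction n with
  | zero =>
    refine ⟨fun k => continuous_const, fun k t => by simp [picard, majorant], fun k t => ?_⟩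
    have h0 : weightedConv (picard α 0) k = 0 := by
      funext s
      simp [weightedConv, picard]
    simp only [picard] at h0
    simp only [picard, h0, majorant, Pi.zero_apply, sub_zero, add_zero]
    exact (enorm_duhamel_zero_le k (α k) t).trans le_self_add
  | succ n ih =>
    obtain ⟨hc, hb, hd⟩ := ih
    have hc' : ∀ k, Continuous (picard α (n + 1) k) := fun k =>
      continuous_duhamel k _ (continuous_weightedConv hc hb (hfin n k))
    have hb' : ∀ k t, ‖picard α (n + 1) k t‖ₑ ≤ majorant α (n + 1) k := fun k t => by
      calc ‖picard α (n + 1) k t‖ₑ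
          = ‖(picard α (n + 1) k t - picard α n k t) + picard α n k t‖ₑ := by
            rw [sub_add_cancel]
        _ ≤ ‖picard α (n + 1) k t - picard α n k t‖ₑ + ‖picard α n k t‖ₑ := enorm_add_le _ _
        _ ≤ ‖picard α (n + 1) k t - picard α n k t‖ₑ + majorant α n k := by
            gcongr
            exact hb k t
        _ ≤ _ := hd k t
    refine ⟨hc', hb', fun k t => ?_⟩
    have hN : ∀ s, ‖weightedConv (picard α (n + 1)) k s - weightedConv (picard α n) k s‖ₑ
        ≤ majorantConv (majorant α (n + 1)) k - majorantConv (majorant α n) k := fun s =>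
      ENNReal.le_sub_of_add_le_right (hfin n k)
        (enorm_weightedConv_sub_add_le hb hb' hd (hfin n k) (hfin (n + 1) k) s)
    have h1 := enorm_duhamel_sub_le k (α k) (continuous_weightedConv hc' hb' (hfin (n + 1) k))
      (continuous_weightedConv hc hb (hfin n k)) hN t
    change ‖duhamel k (α k) (weightedConv (picard α (n + 1)) k) t
      - duhamel k (α k) (weightedConv (picard α n) k) t‖ₑ
      + (‖α k‖ₑ + majorantConv (majorant α n) k) ≤ ‖α k‖ₑ + majorantConv (majorant α (n + 1)) k
    have h2 : majorantConv (majorant α n) k ≤ majorantConv (majorant α (n + 1)) k :=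
      majorantConv_mono (majorant_le_succ α n) k
    calc _ ≤ (majorantConv (majorant α (n + 1)) k - majorantConv (majorant α n) k)
          + (‖α k‖ₑ + majorantConv (majorant α n) k) := by gcongr
      _ = ‖α k‖ₑ + ((majorantConv (majorant α (n + 1)) k - majorantConv (majorant α n) k)
          + majorantConv (majorant α n) k) := by ring
      _ = _ := by rw [tsub_add_cancel_of_le h2]

/-- The Picard iteration converges to a fixed point of the Duhamel operator. -/
theorem exists_fixedPoint (hS : quarticSum ≠ ⊤) (hL : ∑' k, majorantLimit α k ^ 2 ≠ ⊤)
    (hα : ∀ k, (starRingEnd ℂ) (α k) = α (-k)) :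
    ∃ β : ℤ → ℝ → ℂ, (∀ k, Continuous (β k)) ∧ (∀ k t, ‖β k t‖ₑ ≤ majorantLimit α k) ∧
      (∀ k t, (starRingEnd ℂ) (β k t) = β (-k) t) ∧
      (∀ k, Continuous (weightedConv β k)) ∧
      ∀ k, β k = duhamel k (α k) (weightedConv β k) := by
  have hfin := majorantConv_limit_ne_top hS hL
  have hfinL := majorantConv_ne_top hS hL
  have hLk : ∀ k, majorantLimit α k ≠ ⊤ := fun k htop => hL (top_le_iff.1
    ((by simp [htop] : ⊤ ≤ majorantLimit α k ^ 2).trans (ENNReal.le_tsum k)))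
  have hprop := picard_properties hS hL
  have hmk : ∀ n k, majorant α n k ≠ ⊤ := fun n k =>
    ne_top_of_le_ne_top (hLk k) (majorant_le_limit α n k)
  have htel : ∀ k t n m, n ≤ m →
      ‖picard α m k t - picard α n k t‖ₑ + majorant α n k ≤ majorant α m k := by
    intro k t n m hnm
    induction m, hnm using Nat.le_induction with
    | base => simp
    | succ m _ ih =>
      calc ‖picard α (m + 1) k t - picard α n k t‖ₑ + majorant α n k
          = ‖(picard α (m + 1) k t - picard α m k t) + (picard α m k t - picard α n k t)‖ₑ
            + majorant α n k := by rw [sub_add_sub_cancel]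
        _ ≤ ‖picard α (m + 1) k t - picard α m k t‖ₑ + ‖picard α m k t - picard α n k t‖ₑ
            + majorant α n k := by gcongr; exact enorm_add_le _ _
        _ ≤ ‖picard α (m + 1) k t - picard α m k t‖ₑ + majorant α m k := by
            rw [add_assoc]; gcongr
        _ ≤ _ := (hprop m).2.2 k t
  -- This gap controls the tails of the iterates independently of `t`, so convergence is uniform in
  -- time for each mode.
  have hgap : ∀ k, Tendsto (fun n => majorantLimit α k - majorant α n k) atTop (𝓝 0) := fun k => by
    have := ENNReal.Tendsto.sub (tendsto_const_nhds (x := majorantLimit α k))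
      (tendsto_majorant α k) (Or.inl (hLk k))
    simpa using this
  have hdist : ∀ k t n m, n ≤ m →
      ‖picard α m k t - picard α n k t‖ₑ ≤ majorantLimit α k - majorant α n k :=
    fun k t n m hnm => ENNReal.le_sub_of_add_le_right (hmk n k)
      ((htel k t n m hnm).trans (majorant_le_limit α m k))
  have hcauchy : ∀ k t, CauchySeq fun n => picard α n k t := fun k t => by
    refine EMetric.cauchySeq_iff_le_tendsto_0.2
      ⟨fun n => (majorantLimit α k - majorant α n k) + (majorantLimit α k - majorant α n k),
        fun n m N hn hm => ?_, by simpa using (hgap k).add (hgap k)⟩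
    refine (edist_triangle _ (picard α N k t) _).trans (add_le_add ?_ ?_)
    · rw [edist_eq_enorm_sub]
      exact hdist k t N n hn
    · rw [edist_comm, edist_eq_enorm_sub]
      exact hdist k t N m hm
  choose β hβ using fun k t => cauchySeq_tendsto_of_complete (hcauchy k t)
  have hβd : ∀ k t n, ‖β k t - picard α n k t‖ₑ + majorant α n k ≤ majorantLimit α k := by
    intro k t n
    have h : Tendsto (fun m => ‖picard α m k t - picard α n k t‖ₑ + majorant α n k) atTop
        (𝓝 (‖β k t - picard α n k t‖ₑ + majorant α n k)) :=
      ((hβ k t).sub_const _).enorm.add tendsto_const_nhds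
    refine le_of_tendsto h ?_
    filter_upwards [eventually_ge_atTop n] with m hm
    exact (htel k t n m hm).trans (majorant_le_limit α m k)
  have hβb : ∀ k t, ‖β k t‖ₑ ≤ majorantLimit α k := fun k t => by
    simpa [picard, majorant] using hβd k t 0
  have hβc : ∀ k, Continuous (β k) := by
    intro k
    refine TendstoUniformly.continuous (F := fun n => picard α n k) (p := atTop) ?_
      (Eventually.of_forall fun n => (hprop n).1 k).frequently
    rw [EMetric.tendstoUniformly_iff]
    intro ε hε
    filter_upwards [(hgap k).eventually (gt_mem_nhds hε)] with n hn t
    rw [edist_eq_enorm_sub]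
    exact (ENNReal.le_sub_of_add_le_right (hmk n k) (hβd k t n)).trans_lt hn
  have hNc : ∀ k, Continuous (weightedConv β k) := fun k =>
    continuous_weightedConv hβc hβb (hfinL k)
  refine ⟨β, hβc, hβb, fun k t => ?_, hNc, fun k => ?_⟩
  · refine tendsto_nhds_unique ((Complex.continuous_conj.tendsto _).comp (hβ k t)) ?_
    simpa only [Function.comp_def, conj_picard hα] using hβ (-k) t
  · funext t
    refine tendsto_nhds_unique ((tendsto_add_atTop_iff_nat 1).2 (hβ k t)) ?_
    have hN : ∀ n s, ‖weightedConv β k s - weightedConv (picard α n) k s‖ₑ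
        ≤ majorantConv (majorantLimit α) k - majorantConv (majorant α n) k := fun n s =>
      ENNReal.le_sub_of_add_le_right (hfin n k)
        (enorm_weightedConv_sub_add_le (hprop n).2.1 hβb (fun k s => hβd k s n) (hfin n k)
          (hfinL k) s)
    rw [tendsto_iff_edist_tendsto_0]
    have hg := (tendsto_add_atTop_iff_nat 1).2 (hgap k)
    refine tendsto_of_tendsto_of_tendsto_of_le_of_le tendsto_const_nhds hg (fun n => zero_le)
      fun n => ?_
    rw [edist_comm, edist_eq_enorm_sub]
    refine (enorm_duhamel_sub_le k (α k) (hNc k)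
      (continuous_weightedConv (hprop n).1 (hprop n).2.1 (hfin n k)) (hN n) t).trans ?_
    -- The gap of the convolutions is at most the next gap of the majorants, because the limit is a
    -- supersolution.
    refine ENNReal.le_sub_of_add_le_right (hmk (n + 1) k) ?_
    have h2 : majorantConv (majorant α n) k ≤ majorantConv (majorantLimit α) k :=
      majorantConv_mono (majorant_le_limit α n) k
    calc majorantConv (majorantLimit α) k - majorantConv (majorant α n) k
          + (‖α k‖ₑ + majorantConv (majorant α n) k)
        = ‖α k‖ₑ + (majorantConv (majorantLimit α) k - majorantConv (majorant α n) k
          + majorantConv (majorant α n) k) := by ring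
      _ = ‖α k‖ₑ + majorantConv (majorantLimit α) k := by rw [tsub_add_cancel_of_le h2]
      _ ≤ _ := le_majorantLimit α hLk k

end Picard

/-! ### Global solutions for small data in Fourier variables -/

theorem tsum_enorm_inv_pow (m : ℕ) (hm : 1 < m) :
    ∑' j : ℤ, ‖(j : ℂ)⁻¹‖ₑ ^ m = ENNReal.ofReal (∑' j : ℤ, |1 / (j : ℝ) ^ m|) := by
  rw [ENNReal.ofReal_tsum_of_nonneg (fun j => abs_nonneg _)
    (Real.summable_one_div_int_pow.2 hm).abs]
  refine tsum_congr fun j => ?_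
  rw [← ofReal_norm, ← ENNReal.ofReal_pow (norm_nonneg _)]
  congr 1
  rw [norm_inv, Complex.norm_intCast, abs_div, abs_one, abs_pow, one_div, inv_pow]

theorem quarticSum_eq : quarticSum = ENNReal.ofReal (Real.pi ^ 4 / 45) := by
  rw [quarticSum, tsum_enorm_inv_pow 4 (by norm_num)]
  congr 1
  have h : HasSum (fun j : ℤ => |1 / (j : ℝ) ^ 4|)
      (Real.pi ^ 4 / 90 + Real.pi ^ 4 / 90 - |1 / ((0 : ℤ) : ℝ) ^ 4|) := by
    refine HasSum.of_nat_of_neg ?_ ?_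
    · simpa using hasSum_zeta_four
    · simpa using hasSum_zeta_four
  rw [h.tsum_eq]
  norm_num
  ring

theorem quarticSum_ne_top : quarticSum ≠ ⊤ := quarticSum_eq ▸ ENNReal.ofReal_ne_top

/-- Bootstrap gaining one power per step: decay of order `m` for `β j` is decay of order `m + 1` for
`β j / j`. Convolution keeps this order because `β j / j` is summable, and the Duhamel formula keeps
it because `α` decays rapidly. -/
theorem fixedPoint_decay {α : ℤ → ℂ} {β : ℤ → ℝ → ℂ} {b : ℤ → ℝ≥0∞}
    (hα : ∀ m : ℕ, ∃ C : ℝ, ∀ k : ℤ, |(k : ℝ)| ^ m * ‖α k‖ ≤ C) (hL : ∑' k, b k ^ 2 ≠ ⊤)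
    (hb : ∀ k t, ‖β k t‖ₑ ≤ b k) (hNc : ∀ k, Continuous (weightedConv β k))
    (hfix : ∀ k, β k = duhamel k (α k) (weightedConv β k)) (m : ℕ) :
    ∃ C : ℝ, ∀ (k : ℤ) t, |(k : ℝ)| ^ m * ‖β k t‖ ≤ C := by
  -- Cauchy-Schwarz: both `1 / j` and `b` are square summable.
  have hW : ∑' j : ℤ, ‖(j : ℂ)⁻¹‖ₑ * b j ≠ ⊤ := by
    have h := sq_tsum_mul_le (fun j : ℤ => ‖(j : ℂ)⁻¹‖ₑ) b
    rw [tsum_enorm_inv_pow 2 one_lt_two] at h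
    intro htop
    rw [htop] at h
    exact ENNReal.mul_ne_top ENNReal.ofReal_ne_top hL (top_le_iff.1 (le_trans (by simp) h))
  have hterm : ∀ t, ∀ j : ℤ, ‖(j : ℂ)⁻¹‖ * ‖β j t‖ ≤ (‖(j : ℂ)⁻¹‖ₑ * b j).toReal := fun t j => by
    rw [← norm_mul, ← ENNReal.ofReal_le_iff_le_toReal (ENNReal.ne_top_of_tsum_ne_top hW j),
      ofReal_norm, enorm_mul]
    gcongr
    exact hb j t
  have hWs := ENNReal.summable_toReal hW
  have hs : ∀ t, Summable fun j : ℤ => ‖(j : ℂ)⁻¹‖ * ‖β j t‖ := fun t =>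
    Summable.of_nonneg_of_le (fun j => by positivity) (hterm t) hWs
  induction m with
  | zero =>
    refine ⟨((∑' k, b k ^ 2).toReal) + 1, fun k t => ?_⟩
    rw [pow_zero, one_mul]
    have h1 : ‖β k t‖ ^ 2 ≤ (∑' k, b k ^ 2).toReal := by
      rw [← ENNReal.ofReal_le_iff_le_toReal hL, ENNReal.ofReal_pow (norm_nonneg _), ofReal_norm]
      exact (pow_le_pow_left' (hb k t) 2).trans (ENNReal.le_tsum (f := fun k => b k ^ 2) k)
    nlinarith [sq_nonneg (‖β k t‖ - 1), norm_nonneg (β k t)]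
  | succ m ih =>
    obtain ⟨C, hC⟩ := ih
    obtain ⟨C', hC'⟩ := hα (m + 1)
    set A := ∑' j : ℤ, (‖(j : ℂ)⁻¹‖ₑ * b j).toReal
    refine ⟨C' + 2 ^ (m + 1) * (2 * C * A), fun k t => ?_⟩
    have hN : ∀ s, |(k : ℝ)| ^ (m + 1) * ‖weightedConv β k s‖ ≤ 2 ^ (m + 1) * (2 * C * A) := by
      intro s
      have h := summable_conv_and_pow_mul_le (a := fun j : ℤ => ‖(j : ℂ)⁻¹‖ * ‖β j s‖)
        (fun j => by positivity) (hs s) ((hs s).tsum_le_tsum (hterm s) hWs) (n := m + 1) (C := C)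
        (fun j => by
          rcases eq_or_ne j 0 with rfl | hj
          · simpa using (mul_nonneg (by positivity) (norm_nonneg _)).trans (hC 0 s)
          · have hj' : |(j : ℝ)| ≠ 0 := by positivity
            rw [norm_inv, Complex.norm_intCast, pow_succ]
            calc |(j : ℝ)| ^ m * |(j : ℝ)| * (|(j : ℝ)|⁻¹ * ‖β j s‖)
                = |(j : ℝ)| ^ m * ‖β j s‖ * (|(j : ℝ)| * |(j : ℝ)|⁻¹) := by ring
              _ = |(j : ℝ)| ^ m * ‖β j s‖ := by rw [mul_inv_cancel₀ hj', mul_one]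
              _ ≤ C := hC j s) k
      refine le_trans ?_ h.2
      gcongr
      rw [weightedConv]
      refine (norm_tsum_le_tsum_norm (h.1.congr fun j => ?_)).trans_eq (tsum_congr fun j => ?_)
      · rw [norm_mul, norm_mul, norm_mul]
      · rw [norm_mul, norm_mul, norm_mul]
    rcases eq_or_ne k 0 with rfl | hk
    · have h1 := hC' 0
      have h2 := hN 0
      simp only [Int.cast_zero, abs_zero, ne_eq, Nat.add_eq_zero_iff, one_ne_zero, and_false,
        not_false_eq_true, zero_pow, zero_mul] at h1 h2 ⊢
      linarith
    · have hk' : 0 < |(k : ℝ)| ^ (m + 1) := by positivity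
      have h1 := norm_duhamel_le k (α k) (hNc k)
        (C := 2 ^ (m + 1) * (2 * C * A) / |(k : ℝ)| ^ (m + 1))
        (fun s => (le_div_iff₀ hk').2 (by rw [mul_comm]; exact hN s)) t
      rw [← hfix k] at h1
      calc |(k : ℝ)| ^ (m + 1) * ‖β k t‖
          ≤ |(k : ℝ)| ^ (m + 1)
            * (‖α k‖ + 2 ^ (m + 1) * (2 * C * A) / |(k : ℝ)| ^ (m + 1)) := by gcongr
        _ = |(k : ℝ)| ^ (m + 1) * ‖α k‖ + 2 ^ (m + 1) * (2 * C * A) := by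
            rw [mul_add, mul_div_cancel₀ _ hk'.ne']
        _ ≤ _ := by gcongr; exact hC' k

theorem exists_isFourierSolution {a : ℤ → ℂ}
    (hdecay : ∀ m : ℕ, ∃ C : ℝ, ∀ k : ℤ, |(k : ℝ)| ^ m * ‖a k‖ ≤ C) (h0 : a 0 = 0)
    (hconj : ∀ k, (starRingEnd ℂ) (a k) = a (-k)) {B : ℝ}
    (hB : HasSum (fun k : ℤ => ‖(k : ℂ) ^ 2 * a k‖ ^ 2) B)
    (hsmall : 16 * (Real.pi ^ 4 / 45) * B ≤ 1) :
    ∃ c, IsFourierSolution c ∧ ∀ k, c k 0 = a k := by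
  set α : ℤ → ℂ := fun k => (k : ℂ) ^ 2 * a k with hαdef
  have hB0 : 0 ≤ B := hB.nonneg fun k => by positivity
  have hA : ∑' k, ‖α k‖ₑ ^ 2 = ENNReal.ofReal B := by
    rw [← hB.tsum_eq, ENNReal.ofReal_tsum_of_nonneg (fun k => by positivity) hB.summable]
    refine tsum_congr fun k => ?_
    rw [ENNReal.ofReal_pow (norm_nonneg _), ofReal_norm]
  -- With `Y = 4 B`, the condition `2 B + 2 S Y^2 ≤ Y` becomes `16 S B ≤ 1` for `B > 0`, where `S =
  -- π⁴/45`.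
  have hY : 2 * (∑' k, ‖α k‖ₑ ^ 2) + 2 * (quarticSum * (ENNReal.ofReal (4 * B)) ^ 2)
      ≤ ENNReal.ofReal (4 * B) := by
    rw [hA, quarticSum_eq, ← ENNReal.ofReal_pow (by positivity),
      ← ENNReal.ofReal_mul (by positivity), ← ENNReal.ofReal_ofNat 2,
      ← ENNReal.ofReal_mul (by norm_num), ← ENNReal.ofReal_mul (by norm_num),
      ← ENNReal.ofReal_add (by positivity) (by positivity)]
    refine ENNReal.ofReal_le_ofReal ?_
    nlinarith [mul_le_mul_of_nonneg_right hsmall hB0]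
  have hL : ∑' k, majorantLimit α k ^ 2 ≠ ⊤ :=
    ne_top_of_le_ne_top ENNReal.ofReal_ne_top (tsum_majorantLimit_sq_le hY)
  have hαdecay : ∀ m : ℕ, ∃ C : ℝ, ∀ k : ℤ, |(k : ℝ)| ^ m * ‖α k‖ ≤ C := fun m => by
    obtain ⟨C, hC⟩ := hdecay (m + 2)
    refine ⟨C, fun k => le_trans (le_of_eq ?_) (hC k)⟩
    rw [hαdef, norm_mul, norm_pow, Complex.norm_intCast]
    ring
  obtain ⟨β, hβc, hβb, hβconj, hNc, hfix⟩ := exists_fixedPoint quarticSum_ne_top hL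
    (α := α) (fun k => by simp [hαdef, hconj])
  have hβdecay := fixedPoint_decay hαdecay hL hβb hNc hfix
  have hinv : ∀ k : ℤ, ‖((k : ℂ)⁻¹) ^ 2‖ ≤ 1 := fun k => by
    rw [norm_pow, norm_inv, Complex.norm_intCast]
    refine pow_le_one₀ (by positivity) ?_
    rcases eq_or_ne k 0 with rfl | hk
    · simp
    · exact inv_le_one_of_one_le₀ (by exact_mod_cast Int.one_le_abs hk)
  -- Returning from `k² c_k` to `c_k`; the convention `0⁻¹ = 0` makes the mean vanish.
  refine ⟨fun k t => ((k : ℂ)⁻¹) ^ 2 * β k t, ⟨fun k => continuous_const.mul (hβc k), fun m => ?_,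
    fun t => by simp, fun k t => by simp [hβconj], fun k t ht => ?_⟩, fun k => ?_⟩
  · obtain ⟨C, hC⟩ := hβdecay m
    refine ⟨C, fun k t => le_trans ?_ (hC k t)⟩
    rw [norm_mul]
    gcongr
    exact mul_le_of_le_one_left (norm_nonneg _) (hinv k)
  · have h1 := hasDerivAt_duhamel k (α k) (hNc k) ht
    rw [← hfix k] at h1
    refine (h1.const_mul (((k : ℂ)⁻¹) ^ 2)).congr_deriv ?_
    have e : ∀ (j : ℤ) (z : ℂ), (j : ℂ) * (((j : ℂ)⁻¹) ^ 2 * z) = (j : ℂ)⁻¹ * z := fun j z => by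
      rcases eq_or_ne j 0 with rfl | hj
      · simp
      · have : (j : ℂ) ≠ 0 := by exact_mod_cast hj
        field_simp
    simp only [e]
    rw [weightedConv]
    rcases eq_or_ne k 0 with rfl | hk
    · simp
    · have : (k : ℂ) ≠ 0 := by exact_mod_cast hk
      field_simp
  · change ((k : ℂ)⁻¹) ^ 2 * β k 0 = a k
    rw [hfix k, duhamel_zero]
    rcases eq_or_ne k 0 with rfl | hk
    · simp [h0]
    · have : (k : ℂ) ≠ 0 := by exact_mod_cast hk
      simp only [hαdef]
      field_simp

/-! ### Fourier coefficients of smooth functions -/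

theorem fourierCoefficient_deriv {f : ℝ → ℝ} (hf : ContDiff ℝ ∞ f)
    (pf : Function.Periodic f (2 * Real.pi)) (k : ℤ) :
    fourierCoefficient (deriv f) k = Complex.I * k * fourierCoefficient f k :=
  fourierCoefficient_of_hasWeakDeriv (hasWeakDeriv_of_hasDerivAt (hasDerivAt_of_contDiff hf)
    (contDiff_deriv hf).continuous pf) k

theorem fourierCoefficient_decay (m : ℕ) : ∀ {f : ℝ → ℝ}, ContDiff ℝ ∞ f →
    Function.Periodic f (2 * Real.pi) →
    ∃ C : ℝ, ∀ k : ℤ, |(k : ℝ)| ^ m * ‖fourierCoefficient f k‖ ≤ C := by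
  induction m with
  | zero =>
    intro f hf pf
    have h := hasSum_sq_fourierCoefficient (memLp_two_of_continuous hf.continuous)
    refine ⟨(2 * Real.pi)⁻¹ * (∫ x in (0 : ℝ)..(2 * Real.pi), (f x) ^ 2) + 1, fun k => ?_⟩
    have := le_hasSum h k fun j _ => sq_nonneg _
    rw [pow_zero, one_mul]
    nlinarith [sq_nonneg (‖fourierCoefficient f k‖ - 1), norm_nonneg (fourierCoefficient f k)]
  | succ m ih =>
    intro f hf pf
    obtain ⟨C, hC⟩ := ih (contDiff_deriv hf) (periodic_deriv pf)
    refine ⟨C, fun k => le_trans (le_of_eq ?_) (hC k)⟩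
    rw [fourierCoefficient_deriv hf pf, norm_mul, norm_mul, Complex.norm_I, one_mul,
      Complex.norm_intCast]
    ring

theorem conj_fourierCoefficient (f : ℝ → ℝ) (k : ℤ) :
    (starRingEnd ℂ) (fourierCoefficient f k) = fourierCoefficient f (-k) := by
  have hint : ∀ (f : ℝ → ℂ) (x y : ℝ), (starRingEnd ℂ) (∫ s in x..y, f s)
      = ∫ s in x..y, (starRingEnd ℂ) (f s) := fun f x y => by
    simp only [intervalIntegral, map_sub, integral_conj]
  rw [fourierCoefficient_eq, fourierCoefficient_eq, map_mul, Complex.conj_ofReal, hint]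
  simp only [map_mul, conj_character, Complex.conj_ofReal]

theorem hasSum_fourierCoefficient {f : ℝ → ℝ} (cf : Continuous f)
    (pf : Function.Periodic f (2 * Real.pi)) (hs : Summable (fourierCoefficient f)) (x : ℝ) :
    HasSum (fun k => fourierCoefficient f k * character k x) (f x : ℂ) := by
  have : Fact (0 < 2 * Real.pi) := ⟨Real.two_pi_pos⟩
  have pF : Function.Periodic (fun x => (f x : ℂ)) (2 * Real.pi) := fun x => by simp only [pf x]
  have cF : Continuous pF.lift :=
    continuous_coinduced_dom.2 (Complex.continuous_ofReal.comp cf)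
  let F : C(AddCircle (2 * Real.pi), ℂ) := ⟨pF.lift, cF⟩
  have hchar : ∀ (k : ℤ) (y : ℝ), fourier k (y : AddCircle (2 * Real.pi)) = character k y := by
    intro k y
    rw [fourier_coe_apply, character]
    congr 1
    have : (Real.pi : ℂ) ≠ 0 := by exact_mod_cast Real.pi_ne_zero
    push_cast
    field_simp
  have hco : ∀ k, fourierCoeff F k = fourierCoefficient f k := by
    intro k
    rw [fourierCoeff_eq_intervalIntegral F k 0, zero_add, fourierCoefficient_eq,
      Complex.real_smul]
    congr 1
    refine intervalIntegral.integral_congr fun y _ => ?_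
    simp only [hchar, smul_eq_mul]
    rfl
  have h := has_pointwise_sum_fourier_series_of_summable (f := F)
    ((funext hco : fourierCoeff F = fourierCoefficient f) ▸ hs)
    (x : AddCircle (2 * Real.pi))
  simp only [hco, hchar, smul_eq_mul] at h
  exact h

/-- Global existence for smooth data with small second derivative. -/
theorem exists_isRegularSolution_top {f : ℝ → ℝ} (hf : ContDiff ℝ ∞ f)
    (pf : Function.Periodic f (2 * Real.pi)) (hmean : ∫ x in (0 : ℝ)..(2 * Real.pi), f x = 0)
    (hsmall : ∫ x in (0 : ℝ)..(2 * Real.pi), (deriv (deriv f) x) ^ 2 ≤ 1 / 7) :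
    ∃ v, IsRegularSolution f ⊤ v := by
  have hf' := contDiff_deriv hf
  have pf' := periodic_deriv pf
  have hB := hasSum_sq_fourierCoefficient
    (memLp_two_of_continuous (contDiff_deriv hf').continuous)
  have hk : ∀ k : ℤ, ‖fourierCoefficient (deriv (deriv f)) k‖ ^ 2
      = ‖(k : ℂ) ^ 2 * fourierCoefficient f k‖ ^ 2 := fun k => by
    rw [fourierCoefficient_deriv hf' pf', fourierCoefficient_deriv hf pf]
    simp only [norm_mul, norm_pow, Complex.norm_I]
    ring
  simp only [hk] at hB
  obtain ⟨c, hc, hc0⟩ := exists_isFourierSolution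
    (fun m => fourierCoefficient_decay m hf pf) (fourierCoefficient_zero_of_mean_zero hmean)
    (conj_fourierCoefficient f) hB (by
      have hπ : 0 < Real.pi := Real.pi_pos
      -- Parseval's factor `1 / (2π)` turns `16 π⁴/45 · B` into `16 π³/90` times the integral.
      have h1 : Real.pi ^ 3 ≤ 3.15 ^ 3 := by
        gcongr
        exact Real.pi_lt_d2.le
      calc _ = 16 * Real.pi ^ 3 / 90
            * ∫ x in (0 : ℝ)..(2 * Real.pi), (deriv (deriv f) x) ^ 2 := by
            field_simp; ring
        _ ≤ 16 * 3.15 ^ 3 / 90 * (1 / 7) :=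
            mul_le_mul (by gcongr) hsmall (intervalIntegral.integral_nonneg
              Real.two_pi_pos.le fun x _ => sq_nonneg _) (by norm_num)
        _ ≤ 1 := by norm_num)
  have hs : Summable (fourierCoefficient f) := by
    have := (hc.summable_norm 0 0 0).of_norm
    simpa [character, hc0] using this
  have hinit : realFourierSeries c 0 0 = f := by
    funext x
    have h := (hasSum_fourierCoefficient hf.continuous pf hs x).tsum_eq
    have h2 : fourierSeries c 0 0 x = f x := by
      simpa [fourierSeries, hc0] using h
    rw [realFourierSeries, h2, Complex.ofReal_re]
  exact ⟨_, hinit ▸ hc.isRegularSolution⟩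

/-! ### Gluing -/

theorem IsRegularSolution.shift {u₀ : ℝ → ℝ} {T t₀ : ℝ} {u : ℝ → ℝ → ℝ}
    (hu : IsRegularSolution u₀ (T : EReal) u) (ht₀ : 0 ≤ t₀) :
    IsRegularSolution (u t₀) ((T - t₀ : ℝ) : EReal) fun s => u (t₀ + s) where
  initial := by simp
  memH1 := fun t ht hT => hu.memH1 _ (by linarith)
    (by rw [EReal.coe_lt_coe_iff] at hT ⊢; linarith)
  continuous_h1 := fun t ht hT => by
    rw [EReal.coe_lt_coe_iff] at hT
    have h := hu.continuous_h1 (t₀ + t) (by linarith) (by rw [EReal.coe_lt_coe_iff]; linarith)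
    refine h.comp (tendsto_nhdsWithin_iff.2 ⟨?_, ?_⟩)
    · exact ((continuous_const.add continuous_id).tendsto t).mono_left nhdsWithin_le_nhds
    · filter_upwards [self_mem_nhdsWithin] with s hs
      have := EReal.coe_lt_coe_iff.1 hs.2
      exact ⟨by linarith [hs.1], EReal.coe_lt_coe_iff.2 (by linarith)⟩
  smooth := by
    have hmap : ContDiff ℝ ∞ fun p : ℝ × ℝ => (t₀ + p.1, p.2) :=
      (contDiff_const.add contDiff_fst).prodMk contDiff_snd
    refine hu.smooth.comp hmap.contDiffOn ?_
    rintro ⟨s, x⟩ ⟨hs, -⟩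
    have := EReal.coe_lt_coe_iff.1 hs.2
    exact ⟨⟨by linarith [hs.1], EReal.coe_lt_coe_iff.2 (by linarith)⟩, mem_univ _⟩
  equation := fun t ht hT x => by
    rw [EReal.coe_lt_coe_iff] at hT
    have h := hu.equation (t₀ + t) (by linarith) (by rw [EReal.coe_lt_coe_iff]; linarith) x
    rw [← h]
    exact deriv_comp_const_add (f := fun s => u s x) t₀ t

/-- By uniqueness the pieces agree on the whole overlap `[t₀, T)`. So the glued function is locally
`u` around any `t < T` and locally the shifted `v` around any `t ≥ T > t₀`, and no matching of
derivatives at a seam is needed. -/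
theorem IsRegularSolution.glue {u₀ : ℝ → ℝ} {T t₀ : ℝ} {u v : ℝ → ℝ → ℝ}
    (hu : IsRegularSolution u₀ (T : EReal) u) (ht₀ : 0 < t₀) (hT : t₀ < T)
    (hv : IsRegularSolution (u t₀) ⊤ v) :
    IsRegularSolution u₀ ⊤ fun t => if t < T then u t else v (t - t₀) := by
  set w : ℝ → ℝ → ℝ := fun t => if t < T then u t else v (t - t₀) with hw
  have hwu : ∀ t < T, w t = u t := fun t ht => by simp only [hw, if_pos ht]
  have hwv : ∀ t, t₀ ≤ t → w t = v (t - t₀) := by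
    intro t ht
    by_cases h : t < T
    · rw [hwu t h]
      have := (hu.shift ht₀.le).eq hv (t := t - t₀) (by linarith)
        (EReal.coe_lt_coe_iff.2 (by linarith)) (EReal.coe_lt_top _)
      simpa using this
    · simp only [hw, if_neg h]
  have hwu' : ∀ t < T, ∀ᶠ s in 𝓝 t, w s = u s := fun t ht => by
    filter_upwards [gt_mem_nhds ht] with s hs using hwu s hs
  have hwv' : ∀ t, t₀ < t → ∀ᶠ s in 𝓝 t, w s = v (s - t₀) := fun t ht => by
    filter_upwards [lt_mem_nhds ht] with s hs using hwv s hs.le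
  refine ⟨?_, fun t ht _ => ?_, fun t ht _ => ?_, ?_, fun t ht _ x => ?_⟩
  · rw [hwu 0 (ht₀.trans hT), hu.initial]
  · rcases lt_or_ge t T with h | h
    · rw [hwu t h]
      exact hu.memH1 t ht (EReal.coe_lt_coe_iff.2 h)
    · rw [hwv t (hT.le.trans h)]
      exact hv.memH1 _ (by linarith) (EReal.coe_lt_top _)
  · rcases lt_or_ge t T with h | h
    · have h1 := hu.continuous_h1 t ht (EReal.coe_lt_coe_iff.2 h)
      rw [hwu t h]
      refine Tendsto.congr' (f₁ := fun s => h1Norm (u s - u t)) ?_ (h1.mono_left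
        (nhdsWithin_le_iff.2 ?_))
      · filter_upwards [nhdsWithin_le_nhds (hwu' t h)] with s hs
        rw [hs]
      · filter_upwards [self_mem_nhdsWithin, nhdsWithin_le_nhds (gt_mem_nhds h)] with s hs hs'
        exact ⟨hs.1, EReal.coe_lt_coe_iff.2 hs'⟩
    · have h0 : t₀ < t := hT.trans_le h
      have h1 := hv.continuous_h1 (t - t₀) (by linarith) (EReal.coe_lt_top _)
      rw [hwv t h0.le]
      have h2 : Tendsto (fun s => s - t₀) (𝓝 t)
          (𝓝[{s : ℝ | 0 ≤ s ∧ (s : EReal) < ⊤}] (t - t₀)) := by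
        refine tendsto_nhdsWithin_iff.2 ⟨(continuous_id.sub continuous_const).tendsto t, ?_⟩
        filter_upwards [lt_mem_nhds h0] with s hs
        exact ⟨by linarith, EReal.coe_lt_top _⟩
      refine Tendsto.congr' (f₁ := fun s => h1Norm (v (s - t₀) - v (t - t₀))) ?_
        ((h1.comp h2).mono_left nhdsWithin_le_nhds)
      filter_upwards [nhdsWithin_le_nhds (hwv' t h0)] with s hs
      rw [hs]
  · rintro ⟨t, x⟩ ⟨ht, -⟩
    refine ContDiffAt.contDiffWithinAt ?_
    rcases lt_or_ge t T with h | h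
    · have h1 : ContDiffAt ℝ ∞ (fun p : ℝ × ℝ => u p.1 p.2) (t, x) :=
        hu.smooth.contDiffAt (((isOpen_timeDomain _).prod isOpen_univ).mem_nhds
          ⟨⟨ht.1, EReal.coe_lt_coe_iff.2 h⟩, mem_univ _⟩)
      refine h1.congr_of_eventuallyEq ?_
      filter_upwards [(continuous_fst.tendsto (t, x)).eventually (hwu' t h)] with p hp
      rw [hp]
    · have h0 : t₀ < t := hT.trans_le h
      have h1 : ContDiffAt ℝ ∞ (fun p : ℝ × ℝ => v p.1 p.2) (t - t₀, x) :=
        hv.smooth.contDiffAt (((isOpen_timeDomain _).prod isOpen_univ).mem_nhds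
          ⟨⟨by linarith, EReal.coe_lt_top _⟩, mem_univ _⟩)
      have hmap : ContDiff ℝ ∞ fun p : ℝ × ℝ => (p.1 - t₀, p.2) :=
        (contDiff_fst.sub contDiff_const).prodMk contDiff_snd
      have h2 := h1.comp (t, x) (f := fun p : ℝ × ℝ => (p.1 - t₀, p.2)) hmap.contDiffAt
      refine h2.congr_of_eventuallyEq ?_
      filter_upwards [(continuous_fst.tendsto (t, x)).eventually (hwv' t h0)] with p hp
      rw [hp]
      rfl
  · rcases lt_or_ge t T with h | h
    · have h1 : (fun s => w s x) =ᶠ[𝓝 t] fun s => u s x := by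
        filter_upwards [hwu' t h] with s hs
        rw [hs]
      rw [h1.deriv_eq, hwu t h]
      exact hu.equation t ht (EReal.coe_lt_coe_iff.2 h) x
    · have h0 : t₀ < t := hT.trans_le h
      have h1 : (fun s => w s x) =ᶠ[𝓝 t] fun s => v (s - t₀) x := by
        filter_upwards [hwv' t h0] with s hs
        rw [hs]
      rw [h1.deriv_eq, hwv t h0.le, ← hv.equation (t - t₀) (by linarith) (EReal.coe_lt_top _) x]
      exact deriv_comp_sub_const (f := fun s => v s x) t₀ t

theorem eq_zero_of_criticalTime_nonpos {u₀ : ℝ → ℝ} (hu₀ : MemH1 u₀) (h : criticalTime u₀ ≤ 0) :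
    u₀ = 0 := by
  refine eq_of_integral_sq_sub_nonpos hu₀.continuous continuous_const hu₀.periodic
    memH1_zero.periodic ?_
  rw [criticalTime] at h
  simp only [Pi.zero_apply, sub_zero]
  linarith

end

end SurfaceGrowth

/-! ### The time condition. -/

theorem theorem2p3 (u₀ : ℝ → ℝ) (hu₀ : SurfaceGrowth.MemH1 u₀) (u : ℝ → ℝ → ℝ)
    (hu : SurfaceGrowth.IsRegularSolution u₀ (SurfaceGrowth.criticalTime u₀ : EReal) u) :
    ∃ v : ℝ → ℝ → ℝ,
      SurfaceGrowth.IsRegularSolution u₀ ⊤ v ∧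
      (∀ t : ℝ, 0 ≤ t → t < SurfaceGrowth.criticalTime u₀ → v t = u t) ∧
      (∀ (S : EReal) (w : ℝ → ℝ → ℝ), SurfaceGrowth.IsRegularSolution u₀ S w →
        ∀ t : ℝ, 0 ≤ t → (t : EReal) < S → w t = v t) := by
  obtain ⟨v, hv⟩ : ∃ v, SurfaceGrowth.IsRegularSolution u₀ ⊤ v := by
    -- If the critical time is not positive, `[0, T*)` is empty and `u` gives no information, but
    -- then the datum is zero.
    rcases le_or_gt (SurfaceGrowth.criticalTime u₀) 0 with h | h
    · rw [SurfaceGrowth.eq_zero_of_criticalTime_nonpos hu₀ h]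
      exact ⟨0, SurfaceGrowth.isRegularSolution_zero ⊤⟩
    · obtain ⟨t₀, ht₀, hT, hsmall⟩ := SurfaceGrowth.exists_integral_sq_deriv_deriv_le hu₀ hu h
      have hT' := EReal.coe_lt_coe_iff.2 hT
      have hmem := hu.memH1 t₀ ht₀.le hT'
      obtain ⟨v, hv⟩ := SurfaceGrowth.exists_isRegularSolution_top (hu.contDiff ht₀ hT')
        hmem.periodic hmem.mean_zero hsmall
      exact ⟨_, hu.glue ht₀ hT hv⟩
  refine ⟨v, hv, fun t ht htT => ?_, fun S w hw t ht htS => ?_⟩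
  · exact hv.eq hu ht (EReal.coe_lt_top t) (EReal.coe_lt_coe_iff.2 htT)
  · exact hw.eq hv ht htS (EReal.coe_lt_top t)
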